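/- Let $n\ge 1$ and let $h,g:\mathbb R^n\to\mathbb R$ be differentiable such that $f=h+g$ is $\mu$-strongly convex with respect to the Euclidean norm ($\mu\ge 0$; for $\mu=0$ this means convex) and has a minimizer $x^\ast$. Let $\nabla h$ be $L_h$-Lipschitz ($L_h>0$), let $\nabla g$ be $L_g$-Lipschitz, and let $\beta_1,\dots,\beta_n$ be coordinate Lipschitz constants of $g$, i.e. $|\nabla_i g(x+ue_i)-\nabla_i g(x)|\le\beta_i|u|$ for all $x\in\mathbb R^n$, $u\in\mathbb R$ and $i$. Put $\sqrt{\overline L_g}=\frac1n\sum_{i=1}^n\sqrt{\beta_i}$ and assume $\overline L_g\ge L_h$. Let $\|x^0-x^\ast\|_2\le R$, $\varepsilon>0$, $\delta\in(0,1)$. The oracles return $\nabla h(x)$ for given $x$, and $\nabla_i g(x)$ for given $i,x$. Consider the following three-loop method with proximal parameter $L=L_h$. *Outer loop.* $\mathrm{MS}(x^0,m)$: put $y^0=z^0=x^0$, $A_0=0$. For $k=0,\dots,m-1$ let $a_{k+1}=\frac12\big(\frac1L+\sqrt{\frac1{L^2}+\frac{4A_k}{L}}\big)$, $A_{k+1}=A_k+a_{k+1}$,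 $x^{k+1}=\frac{A_k}{A_{k+1}}y^k+\frac{a_{k+1}}{A_{k+1}}z^k$, let $y^{k+1}$ be the output of the middle loop at $x^{k+1}$, and $z^{k+1}=z^k-a_{k+1}\nabla f(y^{k+1})$. Return $y^m$. If $\mu=0$, run $\mathrm{MS}$ from $x^0$ with $m=\lceil\sqrt{2L_hR^2/\varepsilon}\,\rceil$. If $\mu>0$, run $\mathrm{MS}$ with $m=\lceil\sqrt{8L_h/\mu}\,\rceil$ consecutively $\max(0,\lceil\log_2(\mu R^2/\varepsilon)\rceil)+1$ times, each time from the previous output (one run from $x^0$ if $R=0$). *Middle loop* at $\zeta^0$: for $k=1,2,\dots$ run the inner method from $\zeta^{k-1}$ on $$\varphi_k(v)=\langle\nabla h(\zeta^{k-1}),v-\zeta^{k-1}\rangle+g(v)+\tfrac L2\|v-\zeta^0\|_2^2+\tfrac{L_h}2\|v-\zeta^{k-1}\|_2^2,$$ call the result $\zeta^k$, and stop when $\|\nabla h(\zeta^k)+\nabla g(\zeta^k)+L(\zeta^k-\zeta^0)\|_2\le\frac L2\|\zeta^k-\zeta^0\|_2$, or after $K$ passes; return the last $\zeta^k$. *Inner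 method* (accelerated (proximal) random coordinate descent) on $\varphi=\varphi_k$: put $y=z=\zeta^{k-1}$, $\alpha=L+L_h$, $\sigma=L$, $S=\sum_j\sqrt{\beta_j+\alpha}$, $\tau=2/(1+\sqrt{1+4S^2/\sigma})$, $\eta=1/(\tau S^2)$. Each step sets $x=\tau z+(1-\tau)y$, draws $i$ independently with probability $p_i=\sqrt{\beta_i+\alpha}/S$, and replaces $y$ by $x-\frac1{\beta_i+\alpha}\nabla_i\varphi(x)e_i$ and $z$ by $\frac1{1+\eta\sigma}\big(z+\eta\sigma x-\frac{\eta}{p_i}\nabla_i\varphi(x)e_i\big)$. After $N=\lceil c\,\frac{S}{\sqrt{L+L_h}}\ln\frac{2+L_g/L_h}{\delta}\rceil$ steps return $y$. Then there are absolute constants $c,C>0$ such that, for every cap $K\ge K_0$, where $K_0$ depends only on $n,\beta,L_h,L_g,\mu,R,\varepsilon,\delta$, the output $\hat x$ satisfies, with probability at least $1-\delta$, simultaneously $f(\hat x)-f(x^\ast)\le\varepsilon$ and the following bounds on the number of oracle calls. a) If $\mu=0$ and $\varepsilon\le L_hR^2$: at most $C\sqrt{L_hR^2/\varepsilon}$ gradient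 calls for $h$, and at most $C\,\ln\!\big(\tfrac{2+L_g/L_h}{\delta}\big)\,n\sqrt{\overline L_gR^2/\varepsilon}$ partial-derivative calls for $g$. b) If $0<\mu\le L_h$: at most $C\ln\!\big(2+\tfrac{\mu R^2}{\varepsilon}\big)\sqrt{L_h/\mu}$ gradient calls for $h$, and at most $C\ln\!\big(2+\tfrac{\mu R^2}{\varepsilon}\big)\ln\!\big(\tfrac{2+L_g/L_h}{\delta}\big)\,n\sqrt{\overline L_g/\mu}$ partial-derivative calls for $g$. -/

import Mathlib

noncomputable section

namespace OracleSep

/-- The space `ℝⁿ` with the Euclidean norm. -/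
abbrev Vec (n : ℕ) : Type := EuclideanSpace ℝ (Fin n)

/-! ### Randomized oracle programs -/

/-- A randomized program that has access to two unknown functions `h` and `g` only through oracle
queries: `gradH x` asks for the gradient of `h` at `x`, and `partialG i x` asks for the `i`-th
partial derivative of `g` at `x`.  `sample p` draws a random coordinate with law `p`,
independently of everything drawn before.  In between, arbitrary real computations are free. -/
inductive OracleProg (n : ℕ) (α : Type) : Type
  | done (a : α) : OracleProg n α
  | gradH (x : Vec n) (k : Vec n → OracleProg n α) : OracleProg n α
  | partialG (i : Fin n) (x : Vec n) (k : ℝ → OracleProg n α) : OracleProg n α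
  | sample (p : PMF (Fin n)) (k : Fin n → OracleProg n α) : OracleProg n α

namespace OracleProg

variable {n : ℕ} {α γ : Type}

/-- Sequential composition of programs. -/
def bind : OracleProg n α → (α → OracleProg n γ) → OracleProg n γ
  | done a, f => f a
  | gradH x k, f => gradH x fun v => bind (k v) f
  | partialG i x k, f => partialG i x fun r => bind (k r) f
  | sample p k, f => sample p fun i => bind (k i) f

instance : Monad (OracleProg n) where
  pure := done
  bind := bind

end OracleProg

/-- The result of a run: the returned value, the number of gradient queries for `h` and the number
of partial-derivative queries for `g`. -/
structure Outcome (α : Type) where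
  value : α
  hCalls : ℕ
  gCalls : ℕ

/-- The law of the result of a program when the gradient oracle of `h` is `oh` and the
partial-derivative oracle of `g` is `og`. -/
def OracleProg.run {n : ℕ} {α : Type} (oh : Vec n → Vec n) (og : Fin n → Vec n → ℝ) :
    OracleProg n α → PMF (Outcome α)
  | .done a => PMF.pure ⟨a, 0, 0⟩
  | .gradH x k => (run oh og (k (oh x))).map fun r => ⟨r.value, r.hCalls + 1, r.gCalls⟩
  | .partialG i x k => (run oh og (k (og i x))).map fun r => ⟨r.value, r.hCalls, r.gCalls + 1⟩
  | .sample p k => p.bind fun i => run oh og (k i)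

/-- One call to the gradient oracle of `h`. -/
def askGradH {n : ℕ} (x : Vec n) : OracleProg n (Vec n) := .gradH x .done

/-- One call to the partial-derivative oracle of `g`. -/
def askPartialG {n : ℕ} (i : Fin n) (x : Vec n) : OracleProg n ℝ := .partialG i x .done

/-- One random coordinate with law `p`. -/
def draw {n : ℕ} (p : PMF (Fin n)) : OracleProg n (Fin n) := .sample p .done

/-- Query the partial derivatives of `g` at `x` along the coordinates of a list, storing the
answers in the vector `v`. -/
def askPartialsG {n : ℕ} (x : Vec n) : List (Fin n) → (Fin n → ℝ) → OracleProg n (Vec n)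
  | [], v => pure (WithLp.toLp 2 v)
  | i :: l, v => do
      let d ← askPartialG i x
      askPartialsG x l (Function.update v i d)

/-- The full gradient of `g` at `x`, obtained by `n` calls to the partial-derivative oracle. -/
def askGradG {n : ℕ} (x : Vec n) : OracleProg n (Vec n) :=
  askPartialsG x (List.finRange n) 0

/-! ### Inner method: accelerated (proximal) random coordinate descent -/

open Classical in
/-- The law on the coordinates proportional to the weights `w`.  For positive weights the first
branch applies, see `coordLaw_apply`. -/
def coordLaw {n : ℕ} [NeZero n] (w : Fin n → ℝ) : PMF (Fin n) :=
  if hw : ∑ i, ENNReal.ofReal (w i / ∑ j, w j) = 1 then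
    PMF.ofFintype (fun i => ENNReal.ofReal (w i / ∑ j, w j)) hw
  else PMF.pure 0

theorem coordLaw_apply {n : ℕ} [NeZero n] (w : Fin n → ℝ) (hw : ∀ i, 0 < w i) (i : Fin n) :
    coordLaw w i = ENNReal.ofReal (w i / ∑ j, w j) := by
  have hS : 0 < ∑ j, w j := Finset.sum_pos (fun j _ => hw j) Finset.univ_nonempty
  have h1 : ∑ i, ENNReal.ofReal (w i / ∑ j, w j) = 1 := by
    rw [← ENNReal.ofReal_sum_of_nonneg (fun i _ => (div_pos (hw i) hS).le), ← Finset.sum_div,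
      div_self hS.ne', ENNReal.ofReal_one]
  rw [coordLaw, dif_pos h1, PMF.ofFintype_apply]

/-- The normalizing constant `∑ √(βᵢ + α)`. -/
def rootSum {n : ℕ} (β : Fin n → ℝ) (α : ℝ) : ℝ := ∑ i, √(β i + α)

/-- One step of accelerated random coordinate descent with sampling probabilities
`pᵢ = √(βᵢ + α) / S`, `S = ∑ √(βⱼ + α)`, for the objective `φ(v) = ⟪b, v⟫ + (α / 2) ‖v‖² + g(v)`
with strong convexity parameter `σ`.  The point `y'` is the coordinate gradient step for `φ` with
step length `1 / (βᵢ + α)`; equivalently, it is the proximal coordinate step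
`argmin_t (∂ᵢ g(x) t + (βᵢ / 2) t² + ψ(x + t eᵢ))` for the composite term
`ψ(v) = ⟪b, v⟫ + (α / 2) ‖v‖²`.  Each step makes exactly one partial-derivative call. -/
def rcdStep {n : ℕ} [NeZero n] (β : Fin n → ℝ) (α σ : ℝ) (b : Vec n) (y z : Vec n) :
    OracleProg n (Vec n × Vec n) := do
  let S := rootSum β α
  let τ := 2 / (1 + √(1 + 4 * S ^ 2 / σ))
  let η := 1 / (τ * S ^ 2)
  let x := τ • z + (1 - τ) • y
  let i ← draw (coordLaw fun j => √(β j + α))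
  let d ← askPartialG i x
  let s := d + b i + α * x i
  let p := √(β i + α) / S
  let y' := x - EuclideanSpace.single i (s / (β i + α))
  let z' := (1 / (1 + η * σ)) • (z + (η * σ) • x - EuclideanSpace.single i (η / p * s))
  pure (y', z')

/-- `N` steps of `rcdStep`; returns the last `y`. -/
def rcdLoop {n : ℕ} [NeZero n] (β : Fin n → ℝ) (α σ : ℝ) (b : Vec n) :
    ℕ → Vec n → Vec n → OracleProg n (Vec n)
  | 0, y, _ => pure y
  | N + 1, y, z => do
      let r ← rcdStep β α σ b y z
      rcdLoop β α σ b N r.1 r.2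

/-! ### The three-loop method -/

/-- The parameters of the method: coordinate constants `β` of `g`, smoothness constant `Lh` of `h`,
proximal parameter `L`, number `N` of inner steps, and a cap `K` on the number of passes of the
repeat-until loop. -/
structure Params (n : ℕ) where
  β : Fin n → ℝ
  Lh : ℝ
  L : ℝ
  N : ℕ
  K : ℕ

/-- The repeat-until loop of the gradient method for composite optimization applied to
`F(ζ) = h(ζ) + g(ζ) + (L / 2) ‖ζ - ζ₀‖²`, from the current point `ζ` with `dh = ∇h(ζ)`.
A pass runs the inner method from `ζ` on
`⟪∇h(ζ), v - ζ⟫ + g(v) + (L / 2) ‖v - ζ₀‖² + (Lh / 2) ‖v - ζ‖²`, which up to an additive constant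
is `⟪b, v⟫ + ((L + Lh) / 2) ‖v‖² + g(v)` with `b = ∇h(ζ) - L ζ₀ - Lh ζ`, and stops as soon as the
new point `ζ'` satisfies `‖∇F(ζ')‖ ≤ (L / 2) ‖ζ' - ζ₀‖`.
The inner method is run with strong convexity parameter `L`, which is valid as soon as `h + g` is
convex. -/
def gmcoLoop {n : ℕ} [NeZero n] (P : Params n) (ζ₀ : Vec n) :
    ℕ → Vec n → Vec n → OracleProg n (Vec n)
  | 0, ζ, _ => pure ζ
  | k + 1, ζ, dh => do
      let ζ' ← rcdLoop P.β (P.L + P.Lh) P.L (dh - P.L • ζ₀ - P.Lh • ζ) P.N ζ ζ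
      let dh' ← askGradH ζ'
      let dg' ← askGradG ζ'
      if ‖dh' + dg' + P.L • (ζ' - ζ₀)‖ ≤ P.L / 2 * ‖ζ' - ζ₀‖ then pure ζ'
      else gmcoLoop P ζ₀ k ζ' dh'

/-- Gradient method for composite optimization, started at the proximal centre `ζ₀`. -/
def gmco {n : ℕ} [NeZero n] (P : Params n) (ζ₀ : Vec n) : OracleProg n (Vec n) := do
  let dh ← askGradH ζ₀
  gmcoLoop P ζ₀ P.K ζ₀ dh

/-- Iterations of the Monteiro–Svaiter accelerated proximal method. -/
def msLoop {n : ℕ} [NeZero n] (P : Params n) :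
    ℕ → ℝ → Vec n → Vec n → OracleProg n (Vec n)
  | 0, _, y, _ => pure y
  | m + 1, A, y, z => do
      let a := (1 / P.L + √(1 / P.L ^ 2 + 4 * A / P.L)) / 2
      let A' := A + a
      let x := (A / A') • y + (a / A') • z
      let y' ← gmco P x
      let dh ← askGradH y'
      let dg ← askGradG y'
      msLoop P m A' y' (z - a • (dh + dg))

/-- The Monteiro–Svaiter method with `m` iterations, started at `x₀`. -/
def ms {n : ℕ} [NeZero n] (P : Params n) (m : ℕ) (x₀ : Vec n) : OracleProg n (Vec n) :=
  msLoop P m 0 x₀ x₀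

/-- `t` restarts of the Monteiro–Svaiter method with `m` iterations each. -/
def restartedMS {n : ℕ} [NeZero n] (P : Params n) (m : ℕ) : ℕ → Vec n → OracleProg n (Vec n)
  | 0, x => pure x
  | t + 1, x => do
      let y ← ms P m x
      restartedMS P m t y

/-- The number of inner steps, `⌈c (τ / √(L + Lh)) log ((2 + Lg / Lh) / δ)⌉` with
`τ = ∑ √(βᵢ + L + Lh)`. -/
def innerSteps {n : ℕ} (c : ℝ) (β : Fin n → ℝ) (Lh Lg L δ : ℝ) : ℕ :=
  ⌈c * (rootSum β (L + Lh) / √(L + Lh)) * Real.log ((2 + Lg / Lh) / δ)⌉₊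

/-- The method's parameters for the choice `L = Lh`. -/
def params {n : ℕ} (c : ℝ) (β : Fin n → ℝ) (Lh Lg δ : ℝ) (K : ℕ) : Params n where
  β := β
  Lh := Lh
  L := Lh
  N := innerSteps c β Lh Lg Lh δ
  K := K

/-- The method for merely convex objectives: `⌈√(2 Lh R² / ε)⌉` Monteiro–Svaiter iterations. -/
def convexMethod {n : ℕ} [NeZero n] (c : ℝ) (β : Fin n → ℝ) (Lh Lg R ε δ : ℝ) (K : ℕ)
    (x₀ : Vec n) : OracleProg n (Vec n) :=
  ms (params c β Lh Lg δ K) ⌈√(2 * Lh * R ^ 2 / ε)⌉₊ x₀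

/-- The method for `μ`-strongly convex objectives: `⌈log₂ (μ R² / ε)⌉ + 1` runs (at least one) of
`⌈√(8 Lh / μ)⌉` Monteiro–Svaiter iterations each. -/
def stronglyConvexMethod {n : ℕ} [NeZero n] (c : ℝ) (β : Fin n → ℝ) (Lh Lg μ R ε δ : ℝ) (K : ℕ)
    (x₀ : Vec n) : OracleProg n (Vec n) :=
  restartedMS (params c β Lh Lg δ K) ⌈√(8 * Lh / μ)⌉₊ (⌈Real.logb 2 (μ * R ^ 2 / ε)⌉₊ + 1) x₀

/-! ### The problem class -/

/-- The constant `L̄` with `√L̄ = (1 / n) ∑ √βᵢ`. -/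
def meanConst {n : ℕ} (β : Fin n → ℝ) : ℝ := ((1 / (n : ℝ)) * ∑ i, √(β i)) ^ 2

/-- The assumptions on the problem `min h + g`. -/
structure IsProblem {n : ℕ} (h g : Vec n → ℝ) (β : Fin n → ℝ) (Lh Lg μ : ℝ) : Prop where
  diff_h : Differentiable ℝ h
  diff_g : Differentiable ℝ g
  strongConvex : StrongConvexOn Set.univ μ (fun x => h x + g x)
  smooth_h : ∀ x y, ‖gradient h x - gradient h y‖ ≤ Lh * ‖x - y‖
  smooth_g : ∀ x y, ‖gradient g x - gradient g y‖ ≤ Lg * ‖x - y‖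
  coord_g : ∀ (i : Fin n) (x : Vec n) (u : ℝ),
    |gradient g (x + u • EuclideanSpace.single i (1 : ℝ)) i - gradient g x i| ≤ β i * |u|

/-- The law of the outcome of a program on the problem given by `h` and `g`. -/
def runOn {n : ℕ} (h g : Vec n → ℝ) (prog : OracleProg n (Vec n)) : PMF (Outcome (Vec n)) :=
  prog.run (fun x => gradient h x) (fun i x => gradient g x i)

/-- The event that the returned point is an `ε`-solution, with `x⋆` a minimizer of `h + g`, and
that at most `bh` gradients of `h` and at most `bg` partial derivatives of `g` were computed. -/
def successEvent {n : ℕ} (h g : Vec n → ℝ) (xstar : Vec n) (ε bh bg : ℝ) :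
    Set (Outcome (Vec n)) :=
  {r | (h r.value + g r.value) - (h xstar + g xstar) ≤ ε ∧
    (r.hCalls : ℝ) ≤ bh ∧ (r.gCalls : ℝ) ≤ bg}

end OracleSep

end

noncomputable section

namespace OracleSep

variable {n : ℕ} {α γ : Type}

/-! Accuracy is never left to chance. The middle loop tests its stopping criterion, so every
proximal step satisfies it unless the cap is exhausted; the Monteiro–Svaiter potential then
decreases and each restart halves the squared distance bound, for every outcome of the draws
(`sure_msLoop`, `sure_restartedMS`). Randomness only affects the number of passes.

A pass minimizes the model `passObj`, which majorizes `proxObj`. Convexity of `h + g` and smoothness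
of `h` give `g` curvature at least `-L`, so the model is `L`-strongly convex even if `h` and `g` are
not convex. Its exact minimizer contracts the proximal gap by `2/3` (`passObj_min_le`), and `N`
steps of coordinate descent contract the expected model gap by `θ = 2 (1 - τ) ^ N`
(`expect_rcdLoop_gap_le`).

Put `κ = 2 + Lg / L` and measure the gap in units of `L ‖c - p‖ ^ 2` (`relGap`). A good pass from
the centre `c` leaves a gap close to `1` at most, independently of `Lg`; further good passes
contract it by `3/4` until it is below `1/1000`, and one more stops the loop: `29` passes in all. A
bad pass has probability of order `κ ^ 2 * θ` and costs of order `κ` further passes in expectation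
(`expect_passes_le`). A number `N` proportional to `log (κ / δ)` makes `κ ^ 3 * θ` so small that the
expected excess per proximal step is at most `δ` (`rate_le`, `expect_excess_center_le`).

Excesses add up over the `M` proximal steps, so one application of Markov's inequality to the total
bounds the number of `h`-calls by `32 M` with probability `1 - δ` (`le_successEvent`). No union
bound over the steps is taken, hence no `log M` appears in `N`. Partial-derivative calls are at most
`N + n` times the `h`-calls. -/

/-! ### Expectations and sure properties of oracle programs -/

/-- The outcome of a composition from the outcomes of its two parts. -/
def Outcome.after (r : Outcome α) (r' : Outcome γ) : Outcome γ :=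
  ⟨r'.value, r.hCalls + r'.hCalls, r.gCalls + r'.gCalls⟩

/-- The expectation of `Ψ` over the outcome of a program. -/
def OracleProg.expect (oh : Vec n → Vec n) (og : Fin n → Vec n → ℝ) :
    OracleProg n α → (Outcome α → ℝ) → ℝ
  | .done a, Ψ => Ψ ⟨a, 0, 0⟩
  | .gradH x k, Ψ => expect oh og (k (oh x)) fun r => Ψ ⟨r.value, r.hCalls + 1, r.gCalls⟩
  | .partialG i x k, Ψ => expect oh og (k (og i x)) fun r => Ψ ⟨r.value, r.hCalls, r.gCalls + 1⟩
  | .sample p k, Ψ => ∑ i, (p i).toReal * expect oh og (k i) Ψ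

/-- The property `Q` holds for the outcome of a program whatever the random draws are. -/
def OracleProg.Sure (oh : Vec n → Vec n) (og : Fin n → Vec n → ℝ) :
    OracleProg n α → (Outcome α → Prop) → Prop
  | .done a, Q => Q ⟨a, 0, 0⟩
  | .gradH x k, Q => Sure oh og (k (oh x)) fun r => Q ⟨r.value, r.hCalls + 1, r.gCalls⟩
  | .partialG i x k, Q => Sure oh og (k (og i x)) fun r => Q ⟨r.value, r.hCalls, r.gCalls + 1⟩
  | .sample _ k, Q => ∀ i, Sure oh og (k i) Q

namespace OracleProg

variable {oh : Vec n → Vec n} {og : Fin n → Vec n → ℝ}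

theorem sum_toReal_pmf (p : PMF (Fin n)) : ∑ i, (p i).toReal = 1 := by
  rw [← ENNReal.toReal_sum fun i _ => p.apply_ne_top i, ← tsum_fintype (L := .unconditional _),
    p.tsum_coe, ENNReal.toReal_one]

theorem expect_bind (q : OracleProg n α) (f : α → OracleProg n γ) (Ψ : Outcome γ → ℝ) :
    (q >>= f).expect oh og Ψ =
      q.expect oh og fun r => (f r.value).expect oh og fun r' => Ψ (r.after r') := by
  change (OracleProg.bind q f).expect oh og Ψ = _
  induction q generalizing Ψ with
  | done a => simp [OracleProg.bind, expect, Outcome.after]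
  | gradH x k ih =>
    simp only [OracleProg.bind, expect, ih, Outcome.after, add_right_comm]
  | partialG i x k ih =>
    simp only [OracleProg.bind, expect, ih, Outcome.after, add_right_comm]
  | sample p k ih => simp only [OracleProg.bind, expect, ih]

theorem sure_bind {q : OracleProg n α} {f : α → OracleProg n γ} {Q : Outcome γ → Prop}
    (hq : q.Sure oh og fun r => (f r.value).Sure oh og fun r' => Q (r.after r')) :
    (q >>= f).Sure oh og Q := by
  change (OracleProg.bind q f).Sure oh og Q
  induction q generalizing Q with
  | done a => simpa [OracleProg.bind, Sure, Outcome.after] using hq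
  | gradH x k ih =>
    simp only [OracleProg.bind, Sure, Outcome.after] at hq ⊢
    apply ih
    simpa only [Outcome.after, add_right_comm] using hq
  | partialG i x k ih =>
    simp only [OracleProg.bind, Sure, Outcome.after] at hq ⊢
    apply ih
    simpa only [Outcome.after, add_right_comm] using hq
  | sample p k ih => exact fun i => ih i (hq i)

theorem Sure.imp {q : OracleProg n α} {Q Q' : Outcome α → Prop} (h : q.Sure oh og Q)
    (hQ : ∀ r, Q r → Q' r) : q.Sure oh og Q' := by
  induction q generalizing Q Q' with
  | done a => exact hQ _ h
  | gradH x k ih => exact ih _ h fun r hr => hQ _ hr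
  | partialG i x k ih => exact ih _ h fun r hr => hQ _ hr
  | sample p k ih => exact fun i => ih i (h i) hQ

theorem sure_of_forall (q : OracleProg n α) {Q : Outcome α → Prop} (h : ∀ r, Q r) :
    q.Sure oh og Q := by
  induction q generalizing Q with
  | done a => exact h _
  | gradH x k ih => exact ih _ fun r => h _
  | partialG i x k ih => exact ih _ fun r => h _
  | sample p k ih => exact fun i => ih i h

theorem expect_mono_of_sure {q : OracleProg n α} {Ψ Φ : Outcome α → ℝ}
    (h : q.Sure oh og fun r => Ψ r ≤ Φ r) : q.expect oh og Ψ ≤ q.expect oh og Φ := by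
  induction q generalizing Ψ Φ with
  | done a => exact h
  | gradH x k ih => exact ih _ h
  | partialG i x k ih => exact ih _ h
  | sample p k ih =>
    exact Finset.sum_le_sum fun i _ => mul_le_mul_of_nonneg_left (ih i (h i)) ENNReal.toReal_nonneg

theorem expect_mono (q : OracleProg n α) {Ψ Φ : Outcome α → ℝ} (h : ∀ r, Ψ r ≤ Φ r) :
    q.expect oh og Ψ ≤ q.expect oh og Φ :=
  expect_mono_of_sure (sure_of_forall q h)

theorem expect_congr_of_sure {q : OracleProg n α} {Ψ Φ : Outcome α → ℝ}
    (h : q.Sure oh og fun r => Ψ r = Φ r) : q.expect oh og Ψ = q.expect oh og Φ :=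
  le_antisymm (expect_mono_of_sure (h.imp fun _ hr => hr.le))
    (expect_mono_of_sure (h.imp fun _ hr => hr.ge))

theorem expect_add_const_mul (q : OracleProg n α) (a b : ℝ) (Ψ : Outcome α → ℝ) :
    (q.expect oh og fun r => a + b * Ψ r) = a + b * q.expect oh og Ψ := by
  induction q generalizing Ψ with
  | done x => rfl
  | gradH x k ih => exact ih _ _
  | partialG i x k ih => exact ih _ _
  | sample p k ih =>
    simp only [expect, ih, mul_add, Finset.sum_add_distrib, ← Finset.sum_mul, sum_toReal_pmf,
      one_mul, Finset.mul_sum]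
    congr 1
    exact Finset.sum_congr rfl fun i _ => by ring

theorem expect_nonneg (q : OracleProg n α) {Ψ : Outcome α → ℝ} (h : ∀ r, 0 ≤ Ψ r) :
    0 ≤ q.expect oh og Ψ := by
  have h1 := expect_add_const_mul (oh := oh) (og := og) q 0 0 Ψ
  have h2 := expect_mono (oh := oh) (og := og) q (Ψ := fun r => 0 + 0 * Ψ r) (Φ := Ψ)
    fun r => by simpa using h r
  rw [h1] at h2
  simpa using h2

open Classical in
-- The bridge from the law `run` to the recursive `expect`: all draws are from finite sets, so
-- expectations are finite sums and raise no integrability question.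
theorem toOuterMeasure_run (q : OracleProg n α) (s : Set (Outcome α)) :
    (q.run oh og).toOuterMeasure s =
      ENNReal.ofReal (q.expect oh og fun r => if r ∈ s then 1 else 0) := by
  induction q generalizing s with
  | done a =>
    simp only [run, expect, PMF.toOuterMeasure_pure_apply]
    split_ifs <;> simp
  | gradH x k ih =>
    simp only [run, expect, PMF.toOuterMeasure_map_apply, ih, Set.mem_preimage]
  | partialG i x k ih =>
    simp only [run, expect, PMF.toOuterMeasure_map_apply, ih, Set.mem_preimage]
  | sample p k ih =>
    simp only [run, expect, PMF.toOuterMeasure_bind_apply, ih, tsum_fintype]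
    rw [ENNReal.ofReal_sum_of_nonneg]
    · refine Finset.sum_congr rfl fun i _ => ?_
      rw [ENNReal.ofReal_mul ENNReal.toReal_nonneg, ENNReal.ofReal_toReal (p.apply_ne_top i)]
    · intro i _
      refine mul_nonneg ENNReal.toReal_nonneg (expect_nonneg _ fun r => ?_)
      split_ifs <;> simp

/-- Markov's inequality for a nonnegative function that is at least one off the event `s`. -/
theorem le_toOuterMeasure_run (q : OracleProg n α) (s : Set (Outcome α)) (Ψ : Outcome α → ℝ)
    (δ : ℝ) (hΨ : ∀ r, 0 ≤ Ψ r) (hs : q.Sure oh og fun r => r ∈ s ∨ 1 ≤ Ψ r)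
    (hE : q.expect oh og Ψ ≤ δ) :
    ENNReal.ofReal (1 - δ) ≤ (q.run oh og).toOuterMeasure s := by
  classical
  rw [toOuterMeasure_run]
  refine ENNReal.ofReal_le_ofReal ?_
  have h1 := expect_add_const_mul (oh := oh) (og := og) q 1 (-1) Ψ
  have h2 : (q.expect oh og fun r => 1 + -1 * Ψ r) ≤
      q.expect oh og fun r => if r ∈ s then 1 else 0 := by
    refine expect_mono_of_sure (hs.imp fun r hr => ?_)
    have := hΨ r
    split_ifs with h
    · linarith
    · have := hr.resolve_left h
      linarith
  linarith

@[simp] theorem expect_pure (a : α) (Ψ : Outcome α → ℝ) :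
    (pure a : OracleProg n α).expect oh og Ψ = Ψ ⟨a, 0, 0⟩ := rfl

@[simp] theorem sure_pure (a : α) (Q : Outcome α → Prop) :
    (pure a : OracleProg n α).Sure oh og Q = Q ⟨a, 0, 0⟩ := rfl

@[simp] theorem expect_askGradH (x : Vec n) (Ψ : Outcome (Vec n) → ℝ) :
    (askGradH x).expect oh og Ψ = Ψ ⟨oh x, 1, 0⟩ := rfl

@[simp] theorem sure_askGradH (x : Vec n) (Q : Outcome (Vec n) → Prop) :
    (askGradH x).Sure oh og Q = Q ⟨oh x, 1, 0⟩ := rfl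

@[simp] theorem expect_askPartialG (i : Fin n) (x : Vec n) (Ψ : Outcome ℝ → ℝ) :
    (askPartialG i x).expect oh og Ψ = Ψ ⟨og i x, 0, 1⟩ := rfl

@[simp] theorem sure_askPartialG (i : Fin n) (x : Vec n) (Q : Outcome ℝ → Prop) :
    (askPartialG i x).Sure oh og Q = Q ⟨og i x, 0, 1⟩ := rfl

@[simp] theorem expect_draw (p : PMF (Fin n)) (Ψ : Outcome (Fin n) → ℝ) :
    (draw p).expect oh og Ψ = ∑ i, (p i).toReal * Ψ ⟨i, 0, 0⟩ := rfl

@[simp] theorem sure_draw (p : PMF (Fin n)) (Q : Outcome (Fin n) → Prop) :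
    (draw p).Sure oh og Q = ∀ i, Q ⟨i, 0, 0⟩ := rfl

theorem askPartialsG_outcome (x : Vec n) (l : List (Fin n)) (v : Fin n → ℝ) :
    (askPartialsG x l v).Sure oh og fun r =>
      r = ⟨WithLp.toLp 2 fun i => if i ∈ l then og i x else v i, 0, l.length⟩ := by
  induction l generalizing v with
  | nil => simp [askPartialsG]
  | cons i l ih =>
    rw [askPartialsG]
    apply sure_bind
    rw [sure_askPartialG]
    refine (ih (Function.update v i (og i x))).imp fun r hr => ?_
    rw [hr]
    simp only [Outcome.after, zero_add, List.length_cons, add_comm 1, Outcome.mk.injEq, and_true]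
    congr 1
    funext j
    by_cases hj : j = i
    · subst hj; simp
    · simp [hj]

theorem askGradG_outcome {dg : Vec n → Vec n} (hdg : ∀ i x, og i x = dg x i) (x : Vec n) :
    (askGradG x).Sure oh og fun r => r = ⟨dg x, 0, n⟩ := by
  refine (askPartialsG_outcome x _ _).imp fun r hr => ?_
  rw [hr]
  simp only [List.mem_finRange, if_true, List.length_finRange, Outcome.mk.injEq, and_true]
  ext i
  exact hdg i x

theorem expect_askGradG {dg : Vec n → Vec n} (hdg : ∀ i x, og i x = dg x i) (x : Vec n)
    (Ψ : Outcome (Vec n) → ℝ) : (askGradG x).expect oh og Ψ = Ψ ⟨dg x, 0, n⟩ := by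
  rw [expect_congr_of_sure (Φ := fun _ => Ψ ⟨dg x, 0, n⟩ + 0 * 0)
    ((askGradG_outcome hdg x).imp fun r hr => by rw [hr]; simp), expect_add_const_mul]
  simp

end OracleProg

end OracleSep

namespace OracleSep

/-! ### Quadratic bounds on a function along a gradient field -/

section Quadratic

variable {E : Type*} [NormedAddCommGroup E] [InnerProductSpace ℝ E]

/-- `f` lies above the quadratics with curvature `l` and linear part given by `G`. -/
def LowerQuad (f : E → ℝ) (G : E → E) (l : ℝ) : Prop :=
  ∀ x v, f x + inner ℝ (G x) (v - x) + l / 2 * ‖v - x‖ ^ 2 ≤ f v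

/-- `f` lies below the quadratics with curvature `u` and linear part given by `G`. -/
def UpperQuad (f : E → ℝ) (G : E → E) (u : ℝ) : Prop :=
  ∀ x v, f v ≤ f x + inner ℝ (G x) (v - x) + u / 2 * ‖v - x‖ ^ 2

variable {f f' : E → ℝ} {G G' : E → E} {l l' u u' : ℝ}

theorem LowerQuad.add (hf : LowerQuad f G l) (hf' : LowerQuad f' G' l') :
    LowerQuad (fun x => f x + f' x) (fun x => G x + G' x) (l + l') := by
  intro x v
  have h1 := hf x v
  have h2 := hf' x v
  simp only [inner_add_left]
  linarith

theorem UpperQuad.add (hf : UpperQuad f G u) (hf' : UpperQuad f' G' u') :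
    UpperQuad (fun x => f x + f' x) (fun x => G x + G' x) (u + u') := by
  intro x v
  have h1 := hf x v
  have h2 := hf' x v
  simp only [inner_add_left]
  linarith

theorem UpperQuad.neg (hf : UpperQuad f G u) : LowerQuad (fun x => -f x) (fun x => -G x) (-u) := by
  intro x v
  have h1 := hf x v
  simp only [inner_neg_left]
  linarith

theorem quadratic_expansion (c : ℝ) (a x v : E) :
    c / 2 * ‖v - a‖ ^ 2 =
      c / 2 * ‖x - a‖ ^ 2 + inner ℝ (c • (x - a)) (v - x) + c / 2 * ‖v - x‖ ^ 2 := by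
  have h : v - a = (x - a) + (v - x) := by abel
  rw [h, norm_add_sq_real, real_inner_smul_left]
  ring

theorem lowerQuad_quadratic (c : ℝ) (a : E) :
    LowerQuad (fun v => c / 2 * ‖v - a‖ ^ 2) (fun v => c • (v - a)) c :=
  fun x v => (quadratic_expansion c a x v).ge

theorem upperQuad_quadratic (c : ℝ) (a : E) :
    UpperQuad (fun v => c / 2 * ‖v - a‖ ^ 2) (fun v => c • (v - a)) c :=
  fun x v => (quadratic_expansion c a x v).le

theorem affine_expansion (d : ℝ) (b a x v : E) :
    d + inner ℝ b (v - a) = d + inner ℝ b (x - a) + inner ℝ b (v - x) + 0 / 2 * ‖v - x‖ ^ 2 := by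
  have h : v - a = (x - a) + (v - x) := by abel
  rw [h, inner_add_right]
  ring

theorem lowerQuad_affine (d : ℝ) (b a : E) :
    LowerQuad (fun v => d + inner ℝ b (v - a)) (fun _ => b) 0 :=
  fun x v => (affine_expansion d b a x v).ge

theorem upperQuad_affine (d : ℝ) (b a : E) :
    UpperQuad (fun v => d + inner ℝ b (v - a)) (fun _ => b) 0 :=
  fun x v => (affine_expansion d b a x v).le

/-- The gradient is controlled by the distance to the infimum. -/
theorem UpperQuad.norm_sq_le (hf : UpperQuad f G u) (hu : 0 < u) {m : ℝ} (hm : ∀ v, m ≤ f v)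
    (x : E) : ‖G x‖ ^ 2 ≤ 2 * u * (f x - m) := by
  -- A gradient step of length `1 / u` decreases `f` by at least `‖G x‖ ^ 2 / (2 * u)` and cannot go
  -- below `m`.
  have h1 := hf x (x - (1 / u) • G x)
  have h2 := hm (x - (1 / u) • G x)
  have h3 : x - (1 / u) • G x - x = -((1 / u) • G x) := by abel
  rw [h3, inner_neg_right, real_inner_smul_right, real_inner_self_eq_norm_sq, norm_neg, norm_smul,
    Real.norm_of_nonneg (by positivity)] at h1
  have h4 : -(1 / u * ‖G x‖ ^ 2) + u / 2 * (1 / u * ‖G x‖) ^ 2 = -(‖G x‖ ^ 2 / (2 * u)) := by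
    field_simp; ring
  have h5 : ‖G x‖ ^ 2 / (2 * u) ≤ f x - m := by linarith
  rwa [div_le_iff₀ (by positivity), mul_comm] at h5

theorem UpperQuad.gradient_eq_zero (hf : UpperQuad f G u) (hu : 0 < u) {p : E}
    (hp : ∀ v, f p ≤ f v) : G p = 0 := by
  have h := hf.norm_sq_le hu hp p
  rw [sub_self, mul_zero] at h
  have h' : ‖G p‖ = 0 := by nlinarith [norm_nonneg (G p)]
  exact norm_eq_zero.mp h'

/-- Young's inequality absorbs the linear term of the lower quadratic at `0` into half of its
curvature, so `f` is coercive. -/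
theorem LowerQuad.exists_min [FiniteDimensional ℝ E] (hf : LowerQuad f G l) (hl : 0 < l)
    (hc : Continuous f) : ∃ p, ∀ v, f p ≤ f v := by
  refine hc.exists_forall_le ?_
  have h1 : ∀ v, f 0 + (l / 4 * ‖v‖ ^ 2 - ‖G 0‖ ^ 2 / l) ≤ f v := by
    intro v
    have h := hf 0 v
    rw [sub_zero] at h
    have h2 : -(‖G 0‖ * ‖v‖) ≤ inner ℝ (G 0) v := (abs_le.mp (abs_real_inner_le_norm _ _)).1
    have h3 : ‖G 0‖ * ‖v‖ ≤ l / 4 * ‖v‖ ^ 2 + ‖G 0‖ ^ 2 / l := by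
      have h4 : l / 4 * ‖v‖ ^ 2 + ‖G 0‖ ^ 2 / l - ‖G 0‖ * ‖v‖ =
          (l * ‖v‖ - 2 * ‖G 0‖) ^ 2 / (4 * l) := by
        field_simp; ring
      have h5 : 0 ≤ (l * ‖v‖ - 2 * ‖G 0‖) ^ 2 / (4 * l) := by positivity
      linarith
    linarith
  refine Filter.tendsto_atTop_mono h1 ?_
  have h2 : Filter.Tendsto (fun v : E => ‖v‖) (Filter.cocompact E) Filter.atTop :=
    tendsto_norm_cocompact_atTop
  have h3 := ((Filter.tendsto_pow_atTop (two_ne_zero)).comp h2).const_mul_atTop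
    (show 0 < l / 4 by positivity)
  have h4 := Filter.tendsto_atTop_add_const_right _ (f 0 - ‖G 0‖ ^ 2 / l) h3
  refine h4.congr fun v => ?_
  simp only [Function.comp]
  ring

/-! ### Quadratic bounds from Lipschitz gradients, strong convexity and coordinate constants -/

theorem le_quadratic_of_deriv_bound {ψ ψ' : ℝ → ℝ} {c : ℝ}
    (hψ : ∀ t, HasDerivAt ψ (ψ' t) t) (hc : ∀ t, 0 ≤ t → ψ' t ≤ ψ' 0 + c * t) {t : ℝ} (ht : 0 ≤ t) :
    ψ t ≤ ψ 0 + ψ' 0 * t + c / 2 * t ^ 2 := by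
  have hd : ∀ t, HasDerivAt (fun t => ψ t - (ψ' 0 * t + c / 2 * t ^ 2))
      (ψ' t - (ψ' 0 + c * t)) t := by
    intro t
    refine ((hψ t).sub (((hasDerivAt_id t).const_mul (ψ' 0)).add
      (((hasDerivAt_id t).pow 2).const_mul (c / 2)))).congr_deriv ?_
    simp
    ring
  have hanti : AntitoneOn (fun t => ψ t - (ψ' 0 * t + c / 2 * t ^ 2)) (Set.Ici 0) := by
    refine antitoneOn_of_deriv_nonpos (convex_Ici 0)
      (fun t _ => (hd t).continuousAt.continuousWithinAt)
      (fun t _ => (hd t).differentiableAt.differentiableWithinAt) fun t ht => ?_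
    rw [interior_Ici] at ht
    rw [(hd t).deriv]
    linarith [hc t (le_of_lt ht)]
  have := hanti Set.self_mem_Ici ht ht
  simp only [mul_zero, ne_eq, OfNat.ofNat_ne_zero, not_false_eq_true, zero_pow, add_zero,
    sub_zero] at this
  linarith

variable [CompleteSpace E]

theorem hasDerivAt_line (hf : Differentiable ℝ f) (x v : E) (t : ℝ) :
    HasDerivAt (fun t : ℝ => f (x + t • v)) (inner ℝ (gradient f (x + t • v)) v) t := by
  have h1 := (hf (x + t • v)).hasGradientAt.hasFDerivAt
  have h2 : HasDerivAt (fun t : ℝ => x + t • v) v t := by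
    simpa using ((hasDerivAt_id t).smul_const v).const_add x
  exact (h1.comp_hasDerivAt t h2).congr_deriv (by simp)

theorem upperQuad_of_lipschitz (hf : Differentiable ℝ f)
    (hL : ∀ x y, ‖gradient f x - gradient f y‖ ≤ u * ‖x - y‖) :
    UpperQuad f (gradient f) u := by
  intro x v
  have h := le_quadratic_of_deriv_bound (c := u * ‖v - x‖ ^ 2) (hasDerivAt_line hf x (v - x))
    (fun t ht => ?_) zero_le_one
  · simp only [one_smul, zero_smul, add_zero, add_sub_cancel] at h
    linarith
  · have h1 := real_inner_le_norm
      (gradient f (x + t • (v - x)) - gradient f (x + (0 : ℝ) • (v - x))) (v - x)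
    have h2 := hL (x + t • (v - x)) (x + (0 : ℝ) • (v - x))
    have h3 : x + t • (v - x) - (x + (0 : ℝ) • (v - x)) = t • (v - x) := by
      rw [zero_smul]; abel
    rw [h3, norm_smul, Real.norm_of_nonneg ht] at h2
    rw [inner_sub_left] at h1
    nlinarith [mul_le_mul_of_nonneg_right h2 (norm_nonneg (v - x))]

/-- Strong convexity on the segment bounds the difference quotient of `f` at `x` towards `v`; the
claim is its limit as `t` tends to `0` from the right. -/
theorem lowerQuad_of_strongConvex (hf : Differentiable ℝ f) (hc : StrongConvexOn Set.univ l f) :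
    LowerQuad f (gradient f) l := by
  intro x v
  have hd := (hasDerivAt_line hf x (v - x) 0).tendsto_slope_zero_right
  simp only [zero_add, zero_smul, add_zero, smul_eq_mul] at hd
  have hr : Filter.Tendsto (fun t : ℝ => f v - f x - (1 - t) * (l / 2 * ‖v - x‖ ^ 2))
      (nhdsWithin 0 (Set.Ioi 0)) (nhds (f v - f x - (1 - 0) * (l / 2 * ‖v - x‖ ^ 2))) := by
    apply tendsto_nhdsWithin_of_tendsto_nhds
    exact Continuous.tendsto (by fun_prop) 0
  have hle := le_of_tendsto_of_tendsto hd hr ?_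
  · linarith
  · filter_upwards [Ioo_mem_nhdsGT (zero_lt_one (α := ℝ))] with t ht
    have h := hc.2 (Set.mem_univ x) (Set.mem_univ v) (sub_nonneg.mpr ht.2.le) ht.1.le
      (sub_add_cancel 1 t)
    have h1 : (1 - t) • x + t • v = x + t • (v - x) := by
      rw [sub_smul, one_smul, smul_sub]; abel
    rw [h1, norm_sub_rev x v] at h
    simp only [smul_eq_mul] at h
    rw [inv_mul_le_iff₀ ht.1]
    nlinarith

end Quadratic

theorem coordinate_upper_bound {n : ℕ} {g : Vec n → ℝ} (hg : Differentiable ℝ g) {i : Fin n}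
    {b : ℝ} (hb : ∀ (x : Vec n) (u : ℝ),
      |gradient g (x + u • EuclideanSpace.single i (1 : ℝ)) i - gradient g x i| ≤ b * |u|)
    (x : Vec n) (t : ℝ) :
    g (x + EuclideanSpace.single i t) ≤ g x + t * gradient g x i + b / 2 * t ^ 2 := by
  have h := le_quadratic_of_deriv_bound (c := b * t ^ 2)
    (hasDerivAt_line hg x (EuclideanSpace.single i t)) (fun s hs => ?_) zero_le_one
  · simp only [one_smul, zero_smul, add_zero, EuclideanSpace.inner_single_right] at h
    simp only [RCLike.conj_to_real] at h
    linarith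
  · simp only [EuclideanSpace.inner_single_right, RCLike.conj_to_real, zero_smul, add_zero]
    have h1 := hb x (s * t)
    have h2 : (s * t) • EuclideanSpace.single i (1 : ℝ) = s • EuclideanSpace.single i t := by
      rw [mul_smul]; congr 1; ext j; by_cases hj : j = i <;> simp [hj]
    rw [h2] at h1
    have h3 : t * (gradient g (x + s • EuclideanSpace.single i t) i - gradient g x i) ≤
        |t| * (b * |s * t|) := by
      refine (le_abs_self _).trans ?_
      rw [abs_mul]
      exact mul_le_mul_of_nonneg_left h1 (abs_nonneg t)
    rw [abs_mul, abs_of_nonneg hs] at h3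
    have h4 : |t| * (b * (s * |t|)) = b * t ^ 2 * s := by rw [← sq_abs t]; ring
    linarith

end OracleSep

namespace OracleSep

open OracleProg

variable {n : ℕ} [NeZero n] {oh : Vec n → Vec n} {og : Fin n → Vec n → ℝ}

/-! ### Accelerated random coordinate descent -/

/-- The momentum parameter `τ` of `rcdStep`. -/
def rcdTau (β : Fin n → ℝ) (α σ : ℝ) : ℝ := 2 / (1 + √(1 + 4 * rootSum β α ^ 2 / σ))

/-- The step parameter `η` of `rcdStep`. -/
def rcdEta (β : Fin n → ℝ) (α σ : ℝ) : ℝ := 1 / (rcdTau β α σ * rootSum β α ^ 2)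

theorem rootSum_pos {β : Fin n → ℝ} {α : ℝ} (hw : ∀ i, 0 < β i + α) : 0 < rootSum β α :=
  Finset.sum_pos (fun i _ => Real.sqrt_pos.mpr (hw i)) Finset.univ_nonempty

theorem toReal_coordLaw {β : Fin n → ℝ} {α : ℝ} (hw : ∀ i, 0 < β i + α) (i : Fin n) :
    (coordLaw (fun j => √(β j + α)) i).toReal = √(β i + α) / rootSum β α := by
  rw [coordLaw_apply _ fun j => Real.sqrt_pos.mpr (hw j)]
  exact ENNReal.toReal_ofReal (div_nonneg (Real.sqrt_nonneg _) (rootSum_pos hw).le)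

/-- Here `τ` is the positive root of `σ * (1 - τ) = τ ^ 2 * S ^ 2`. The identity `η τ S² = 1`
balances the gradient step against the variance of the `z`-step; the identity `η σ (1 - τ) = τ`
means `1 / (1 + η σ) = 1 - τ`, so both parts of the potential contract at the same rate. -/
theorem rcdTau_spec {β : Fin n → ℝ} {α σ : ℝ} (hw : ∀ i, 0 < β i + α) (hσ : 0 < σ) :
    0 < rcdTau β α σ ∧ rcdTau β α σ < 1 ∧ 0 < rcdEta β α σ ∧
      rcdEta β α σ * rcdTau β α σ * rootSum β α ^ 2 = 1 ∧
      rcdEta β α σ * σ * (1 - rcdTau β α σ) = rcdTau β α σ := by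
  have hS := rootSum_pos hw
  set S := rootSum β α
  have hr : 1 < √(1 + 4 * S ^ 2 / σ) := by
    rw [Real.lt_sqrt zero_le_one]
    have : 0 < 4 * S ^ 2 / σ := by positivity
    linarith
  have hr2 : √(1 + 4 * S ^ 2 / σ) ^ 2 = 1 + 4 * S ^ 2 / σ := Real.sq_sqrt (by positivity)
  have hτ : rcdTau β α σ = 2 / (1 + √(1 + 4 * S ^ 2 / σ)) := rfl
  have hη : rcdEta β α σ = 1 / (rcdTau β α σ * S ^ 2) := rfl
  set r := √(1 + 4 * S ^ 2 / σ)
  have hτ0 : 0 < rcdTau β α σ := by rw [hτ]; positivity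
  refine ⟨hτ0, ?_, ?_, ?_, ?_⟩
  · rw [hτ, div_lt_one (by positivity)]; linarith
  · rw [hη]; positivity
  · rw [hη]; field_simp
  · have hS2 : S ^ 2 = σ * (r ^ 2 - 1) / 4 := by rw [hr2]; field_simp; ring
    have hr1 : r - 1 ≠ 0 := by linarith
    have hr3 : 1 + r ≠ 0 := by linarith
    rw [hη, hτ, hS2, show r ^ 2 - 1 = (r - 1) * (1 + r) by ring]
    field_simp
    ring

/-- The new pair of points in `rcdStep` when the coordinate `i` is drawn and `s` is the partial
derivative of the objective. -/
def rcdNext (β : Fin n → ℝ) (α σ : ℝ) (y z : Vec n) (G : Vec n → Vec n) (i : Fin n) :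
    Vec n × Vec n :=
  let x := rcdTau β α σ • z + (1 - rcdTau β α σ) • y
  (x - EuclideanSpace.single i (G x i / (β i + α)),
    (1 / (1 + rcdEta β α σ * σ)) • (z + (rcdEta β α σ * σ) • x -
      EuclideanSpace.single i (rcdEta β α σ / (√(β i + α) / rootSum β α) * G x i)))

theorem sure_rcdStep (β : Fin n → ℝ) (α σ : ℝ) (b y z : Vec n) {G : Vec n → Vec n}
    (hG : ∀ i x, og i x + b i + α * x i = G x i) (Q : Outcome (Vec n × Vec n) → Prop)
    (hQ : ∀ i, Q ⟨rcdNext β α σ y z G i, 0, 1⟩) :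
    (rcdStep β α σ b y z).Sure oh og Q := by
  unfold rcdStep
  refine sure_bind ?_
  rw [sure_draw]
  intro i
  refine sure_bind ?_
  rw [sure_askPartialG, sure_pure]
  simp only [hG]
  exact hQ i

theorem expect_rcdStep {β : Fin n → ℝ} {α : ℝ} (hw : ∀ i, 0 < β i + α) (σ : ℝ) (b y z : Vec n)
    {G : Vec n → Vec n} (hG : ∀ i x, og i x + b i + α * x i = G x i)
    (Ψ : Outcome (Vec n × Vec n) → ℝ) :
    (rcdStep β α σ b y z).expect oh og Ψ =
      ∑ i, √(β i + α) / rootSum β α * Ψ ⟨rcdNext β α σ y z G i, 0, 1⟩ := by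
  unfold rcdStep
  simp only [expect_bind, expect_draw, expect_askPartialG, expect_pure, hG, toReal_coordLaw hw]
  rfl

theorem sure_rcdLoop (β : Fin n → ℝ) (α σ : ℝ) (b : Vec n) (N : ℕ) (y z : Vec n) :
    (rcdLoop β α σ b N y z).Sure oh og fun r => r.hCalls = 0 ∧ r.gCalls = N := by
  induction N generalizing y z with
  | zero => simp [rcdLoop]
  | succ N ih =>
    rw [rcdLoop]
    apply sure_bind
    refine sure_rcdStep β α σ b y z
      (G := fun x => WithLp.toLp 2 fun i => og i x + b i + α * x i) (fun i x => rfl) _ fun i => ?_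
    refine (ih _ _).imp fun r hr => ?_
    simp [Outcome.after, hr.1, hr.2, add_comm]

/-- Needed when the proximal centre is already the proximal point, where the normalization of
`relGap` degenerates. -/
theorem sure_rcdLoop_of_critical {β : Fin n → ℝ} {α σ : ℝ} (hw : ∀ i, 0 < β i + α) (hσ : 0 < σ)
    {b p : Vec n} {G : Vec n → Vec n} (hG : ∀ i x, og i x + b i + α * x i = G x i)
    (hp : G p = 0) (N : ℕ) :
    (rcdLoop β α σ b N p p).Sure oh og fun r => r.value = p := by
  induction N with
  | zero => simp [rcdLoop]
  | succ N ih =>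
    rw [rcdLoop]
    apply sure_bind
    refine sure_rcdStep β α σ b p p hG _ fun i => ?_
    have hx : rcdTau β α σ • p + (1 - rcdTau β α σ) • p = p := by
      rw [← add_smul]; simp
    have h0 : (0 : Vec n) i = 0 := rfl
    have hn : rcdNext β α σ p p G i = (p, p) := by
      obtain ⟨-, -, h1, -⟩ := rcdTau_spec hw hσ
      have h2 : 1 + rcdEta β α σ * σ ≠ 0 := by positivity
      have hs : (EuclideanSpace.single i (0 : ℝ)) = (0 : Vec n) := by ext j; simp
      simp only [rcdNext, hx, hp, h0, zero_div, mul_zero, hs, sub_zero, Prod.mk.injEq, true_and]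
      have h3 : p + (rcdEta β α σ * σ) • p = (1 + rcdEta β α σ * σ) • p := by
        rw [add_smul, one_smul]
      rw [h3, smul_smul, one_div_mul_cancel h2, one_smul]
    simp only [hn]
    exact ih.imp fun r hr => hr

/-- Convexity of the squared norm for the mixture of `a - e` and `d` with weights proportional to
`1` and `c`; the defect is `c * ‖a - e - d‖ ^ 2`. -/
theorem norm_sq_mixture_le {E : Type*} [NormedAddCommGroup E] [InnerProductSpace ℝ E]
    (a d e : E) {c : ℝ} (hc : 0 ≤ c) :
    ‖a + c • d - e‖ ^ 2 ≤
      (1 + c) * (‖a‖ ^ 2 + c * ‖d‖ ^ 2 - 2 * inner ℝ a e + ‖e‖ ^ 2) := by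
  have h1 : ‖a + c • d - e‖ ^ 2 + c * ‖a - e - d‖ ^ 2 =
      (1 + c) * (‖a‖ ^ 2 + c * ‖d‖ ^ 2 - 2 * inner ℝ a e + ‖e‖ ^ 2) := by
    have e1 : a + c • d - e = (a - e) + c • d := by abel
    rw [e1, norm_add_sq_real, norm_sub_sq_real (a - e) d, norm_sub_sq_real a e,
      real_inner_smul_right, norm_smul, Real.norm_of_nonneg hc]
    ring
  have h2 : 0 ≤ c * ‖a - e - d‖ ^ 2 := by positivity
  linarith

section Rate

variable {β : Fin n → ℝ} {α σ : ℝ} {φ : Vec n → ℝ} {G : Vec n → Vec n} {b : Vec n}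

/-- The Lyapunov function of accelerated coordinate descent. -/
def rcdPotential (φ : Vec n → ℝ) (σ : ℝ) (p : Vec n) (r : Vec n × Vec n) : ℝ :=
  1 / σ * (φ r.1 - φ p) + ‖r.2 - p‖ ^ 2 / 2

/-- The square of the `z`-step and the decrease from the coordinate step cancel exactly: with `p`
proportional to `w = √(β i + α)` and `η τ S² = 1`, one has `q ^ 2 = (η / τ) * s ^ 2 / w ^ 2`. Only a
term linear in the gradient survives, and the weight `p` removes its factor `1 / p`. -/
theorem rcdNext_potential_le (hw : ∀ i, 0 < β i + α) (hσ : 0 < σ)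
    (hcoord : ∀ i x t,
      φ (x + EuclideanSpace.single i t) ≤ φ x + t * G x i + (β i + α) / 2 * t ^ 2)
    (p y z x : Vec n) (hx : x = rcdTau β α σ • z + (1 - rcdTau β α σ) • y) (i : Fin n) :
    √(β i + α) / rootSum β α * rcdPotential φ σ p (rcdNext β α σ y z G i) ≤
      (1 - rcdTau β α σ) * (√(β i + α) / rootSum β α *
        (‖z - p‖ ^ 2 / 2 + rcdEta β α σ * σ / 2 * ‖x - p‖ ^ 2 +
          rcdEta β α σ / rcdTau β α σ * (φ x - φ p)) - rcdEta β α σ * (G x i * (z - p) i)) := by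
  obtain ⟨hτ0, hτ1, hη0, hητ, hησ⟩ := rcdTau_spec hw hσ
  have hS := rootSum_pos hw
  have hr := Real.sqrt_pos.mpr (hw i)
  have hr2 : √(β i + α) ^ 2 = β i + α := Real.sq_sqrt (hw i).le
  have hc := hcoord i x (-(G x i / (β i + α)))
  simp only [rcdPotential, rcdNext, ← hx]
  set τ := rcdTau β α σ
  set η := rcdEta β α σ
  set S := rootSum β α
  set w := √(β i + α)
  set s := G x i
  rw [← hr2] at hc ⊢
  have h1 : x + EuclideanSpace.single i (-(s / w ^ 2)) = x - EuclideanSpace.single i (s / w ^ 2) := by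
    ext j; by_cases hj : j = i <;> simp [hj, sub_eq_add_neg]
  rw [h1] at hc
  set φ' := φ (x - EuclideanSpace.single i (s / w ^ 2))
  set q := η / (w / S) * s with hq
  have h2 := norm_sq_mixture_le (z - p) (x - p) (EuclideanSpace.single i q)
    (mul_pos hη0 hσ).le
  have h3 : (z - p) + (η * σ) • (x - p) - EuclideanSpace.single i q =
      (z + (η * σ) • x - EuclideanSpace.single i q) - (1 + η * σ) • p := by
    rw [add_smul, one_smul, smul_sub]; abel
  have hpos : 0 < 1 + η * σ := by positivity
  have h4 : (1 / (1 + η * σ)) • (z + (η * σ) • x - EuclideanSpace.single i q) - p =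
      (1 / (1 + η * σ)) • ((z - p) + (η * σ) • (x - p) - EuclideanSpace.single i q) := by
    rw [h3, smul_sub _ _ ((1 + η * σ) • p), smul_smul _ _ p, one_div_mul_cancel hpos.ne', one_smul]
  rw [h4, norm_smul, Real.norm_of_nonneg (by positivity), mul_pow]
  simp only [EuclideanSpace.inner_single_right, RCLike.conj_to_real, PiLp.norm_single,
    Real.norm_eq_abs, sq_abs] at h2
  set T := ‖z - p + (η * σ) • (x - p) - EuclideanSpace.single i q‖ ^ 2
  set u := (z - p) i
  have h5 : (1 / (1 + η * σ)) ^ 2 * T ≤ (1 - τ) *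
      (‖z - p‖ ^ 2 + η * σ * ‖x - p‖ ^ 2 - 2 * (q * u) + q ^ 2) := by
    have e1 : 1 / (1 + η * σ) = 1 - τ := by
      rw [div_eq_iff hpos.ne']; linarith
    have e2 : (1 - τ) * (1 + η * σ) = 1 := by linarith
    rw [e1]
    calc (1 - τ) ^ 2 * T ≤ (1 - τ) ^ 2 * _ := mul_le_mul_of_nonneg_left h2 (sq_nonneg _)
      _ = (1 - τ) * ((1 - τ) * (1 + η * σ)) *
          (‖z - p‖ ^ 2 + η * σ * ‖x - p‖ ^ 2 - 2 * (q * u) + q ^ 2) := by ring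
      _ = _ := by rw [e2, mul_one]
  have h6 : 1 / σ = (1 - τ) * (η / τ) := by
    field_simp
    linarith
  have h7 : w / S * q = η * s := by rw [hq]; field_simp
  have h8 : w / S * q ^ 2 = w / S * (η / τ) * (s ^ 2 / w ^ 2) := by
    rw [hq]; field_simp; linear_combination s ^ 2 * hητ
  have h9 : φ' ≤ φ x - s ^ 2 / w ^ 2 / 2 := by
    have : -(s / w ^ 2) * s + w ^ 2 / 2 * (-(s / w ^ 2)) ^ 2 = -(s ^ 2 / w ^ 2 / 2) := by
      field_simp; ring
    linarith
  have hwS : 0 < w / S := by positivity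
  have h10 := mul_le_mul_of_nonneg_left h5 hwS.le
  have h11 : w / S * ((1 - τ) * (η / τ) * (φ' - φ p)) ≤
      w / S * ((1 - τ) * (η / τ) * (φ x - s ^ 2 / w ^ 2 / 2 - φ p)) := by
    have : 0 < 1 - τ := by linarith
    gcongr
  rw [h6]
  linear_combination h11 + h10 / 2 + (1 - τ) * (-u) * h7 + (1 - τ) / 2 * h8

/-- Averaging over `i` turns the linear term into `⟪G x, z - p⟫`. Since `x` is the mixture of `z`
and `y`, this splits into the directions `p - x` and `y - x`; strong convexity along the former pays
for `‖x - p‖ ^ 2`, and plain convexity suffices along the latter. -/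
theorem expect_rcdStep_potential_le (hw : ∀ i, 0 < β i + α) (hσ : 0 < σ)
    (hG : ∀ i x, og i x + b i + α * x i = G x i) (hlow : LowerQuad φ G σ)
    (hcoord : ∀ i x t,
      φ (x + EuclideanSpace.single i t) ≤ φ x + t * G x i + (β i + α) / 2 * t ^ 2)
    (p y z : Vec n) :
    ((rcdStep β α σ b y z).expect oh og fun r => rcdPotential φ σ p r.value) ≤
      (1 - rcdTau β α σ) * rcdPotential φ σ p (y, z) := by
  rw [expect_rcdStep hw σ b y z hG]
  refine (Finset.sum_le_sum fun i _ =>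
    rcdNext_potential_le hw hσ hcoord p y z _ rfl i).trans ?_
  obtain ⟨hτ0, hτ1, hη0, hητ, hησ⟩ := rcdTau_spec hw hσ
  have hS := rootSum_pos hw
  have hsum : ∑ i, √(β i + α) / rootSum β α = 1 := by
    rw [← Finset.sum_div]; exact div_self hS.ne'
  set x := rcdTau β α σ • z + (1 - rcdTau β α σ) • y with hx
  rw [← Finset.mul_sum, Finset.sum_sub_distrib, ← Finset.sum_mul, hsum, one_mul, ← Finset.mul_sum]
  have hin : ∑ i, G x i * (z - p) i = inner ℝ (G x) (z - p) := by
    rw [PiLp.inner_apply]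
    exact Finset.sum_congr rfl fun i _ => by simp [mul_comm]
  rw [hin]
  set τ := rcdTau β α σ
  set η := rcdEta β α σ
  refine mul_le_mul_of_nonneg_left ?_ (by linarith)
  have h1 := hlow x p
  have h2 := hlow x y
  have h3 : τ * inner ℝ (G x) (z - p) =
      -(τ * inner ℝ (G x) (p - x)) - (1 - τ) * inner ℝ (G x) (y - x) := by
    rw [← real_inner_smul_right, ← real_inner_smul_right, ← real_inner_smul_right,
      ← inner_neg_right, ← inner_sub_right]
    congr 1
    rw [hx]
    module
  have h4 : 1 / σ = η * (1 - τ) / τ := by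
    field_simp
    linarith
  rw [norm_sub_rev p x] at h1
  have h5 : 0 ≤ σ / 2 * ‖y - x‖ ^ 2 := by positivity
  have h6 : η * σ / 2 * ‖x - p‖ ^ 2 * τ + η * (φ x - φ p) - η * (τ * inner ℝ (G x) (z - p)) ≤
      η * (1 - τ) * (φ y - φ p) := by
    rw [h3]
    have h7 := mul_le_mul_of_nonneg_left h1 hτ0.le
    have h8 : (1 - τ) * (φ x + inner ℝ (G x) (y - x)) ≤ (1 - τ) * φ y :=
      mul_le_mul_of_nonneg_left (by linarith) (by linarith)
    have h9 := mul_le_mul_of_nonneg_left (add_le_add h7 h8) hη0.le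
    linarith
  simp only [rcdPotential]
  rw [h4]
  have h7 : η * σ / 2 * ‖x - p‖ ^ 2 + η / τ * (φ x - φ p) - η * inner ℝ (G x) (z - p) ≤
      η * (1 - τ) / τ * (φ y - φ p) := by
    rw [div_mul_eq_mul_div _ τ (φ y - φ p), le_div_iff₀ hτ0]
    refine le_of_eq_of_le ?_ h6
    field_simp
  linarith

theorem expect_rcdLoop_potential_le (hw : ∀ i, 0 < β i + α) (hσ : 0 < σ)
    (hG : ∀ i x, og i x + b i + α * x i = G x i) (hlow : LowerQuad φ G σ)
    (hcoord : ∀ i x t,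
      φ (x + EuclideanSpace.single i t) ≤ φ x + t * G x i + (β i + α) / 2 * t ^ 2)
    (p : Vec n) (N : ℕ) (y z : Vec n) :
    ((rcdLoop β α σ b N y z).expect oh og fun r => 1 / σ * (φ r.value - φ p)) ≤
      (1 - rcdTau β α σ) ^ N * rcdPotential φ σ p (y, z) := by
  obtain ⟨-, hτ1, -⟩ := rcdTau_spec hw hσ
  induction N generalizing y z with
  | zero =>
    simp only [rcdLoop, expect_pure, rcdPotential, pow_zero, one_mul]
    linarith [sq_nonneg ‖z - p‖]
  | succ N ih =>
    rw [rcdLoop, expect_bind]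
    refine (expect_mono _ fun r : Outcome (Vec n × Vec n) => ih r.value.1 r.value.2).trans ?_
    have h := expect_add_const_mul (oh := oh) (og := og) (rcdStep β α σ b y z) 0
      ((1 - rcdTau β α σ) ^ N) fun r => rcdPotential φ σ p r.value
    simp only [zero_add] at h
    rw [h, pow_succ, mul_assoc]
    exact mul_le_mul_of_nonneg_left (expect_rcdStep_potential_le hw hσ hG hlow hcoord p y z)
      (pow_nonneg (by linarith) _)

/-- Linear convergence of accelerated coordinate descent in expectation. -/
theorem expect_rcdLoop_gap_le (hw : ∀ i, 0 < β i + α) (hσ : 0 < σ)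
    (hG : ∀ i x, og i x + b i + α * x i = G x i) (hlow : LowerQuad φ G σ)
    (hcoord : ∀ i x t,
      φ (x + EuclideanSpace.single i t) ≤ φ x + t * G x i + (β i + α) / 2 * t ^ 2)
    {p : Vec n} (hp : G p = 0) (N : ℕ) (y : Vec n) :
    ((rcdLoop β α σ b N y y).expect oh og fun r => φ r.value - φ p) ≤
      2 * (1 - rcdTau β α σ) ^ N * (φ y - φ p) := by
  obtain ⟨-, hτ1, -⟩ := rcdTau_spec hw hσ
  have h1 := expect_rcdLoop_potential_le (oh := oh) hw hσ hG hlow hcoord p N y y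
  have h2 := expect_add_const_mul (oh := oh) (og := og) (rcdLoop β α σ b N y y) 0
    (1 / σ) fun r => φ r.value - φ p
  simp only [zero_add] at h2
  rw [h2] at h1
  -- With `z = y` at the start, strong convexity bounds the distance part of the potential by the
  -- gap part; hence the factor `2`.
  have h3 := hlow p y
  rw [hp, inner_zero_left, add_zero] at h3
  have h4 : rcdPotential φ σ p (y, y) ≤ 1 / σ * (2 * (φ y - φ p)) := by
    have : ‖y - p‖ ^ 2 / 2 = 1 / σ * (σ / 2 * ‖y - p‖ ^ 2) := by field_simp
    simp only [rcdPotential]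
    rw [this, ← mul_add]
    exact mul_le_mul_of_nonneg_left (by linarith) (by positivity)
  have h5 := h1.trans (mul_le_mul_of_nonneg_left h4 (pow_nonneg (by linarith) N))
  have h6 : 0 < 1 / σ := by positivity
  refine le_of_mul_le_mul_left (h5.trans_eq ?_) h6
  ring

end Rate

end OracleSep

namespace OracleSep

open OracleProg

/-! ### One pass of the gradient method for composite optimization -/

/-- The objective `h + g + (L / 2) ‖· - c‖²` of the proximal step at `c`. -/
def proxObj {n : ℕ} (h g : Vec n → ℝ) (L : ℝ) (c v : Vec n) : ℝ :=
  h v + g v + L / 2 * ‖v - c‖ ^ 2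

/-- The gradient of `proxObj`. -/
def proxGrad {n : ℕ} (h g : Vec n → ℝ) (L : ℝ) (c v : Vec n) : Vec n :=
  gradient h v + gradient g v + L • (v - c)

/-- The model of `proxObj` around `ζ`, with `h` replaced by its quadratic upper bound. -/
def passObj {n : ℕ} (h g : Vec n → ℝ) (L : ℝ) (c ζ v : Vec n) : ℝ :=
  h ζ + inner ℝ (gradient h ζ) (v - ζ) + g v + L / 2 * ‖v - c‖ ^ 2 + L / 2 * ‖v - ζ‖ ^ 2

/-- The gradient of `passObj`. -/
def passGrad {n : ℕ} (h g : Vec n → ℝ) (L : ℝ) (c ζ v : Vec n) : Vec n :=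
  gradient h ζ + gradient g v + L • (v - c) + L • (v - ζ)

/-- The stopping criterion of the gradient method for composite optimization. -/
def ProxCrit {n : ℕ} (h g : Vec n → ℝ) (L : ℝ) (c v : Vec n) : Prop :=
  ‖proxGrad h g L c v‖ ≤ L / 2 * ‖v - c‖

/-! ### Curvature and minimizers of the proximal objective and of its model -/

namespace IsProblem

variable {n : ℕ} {h g : Vec n → ℝ} {β : Fin n → ℝ} {L Lg μ : ℝ}

theorem beta_nonneg (hP : IsProblem h g β L Lg μ) (i : Fin n) : 0 ≤ β i := by
  have := (abs_nonneg _).trans (hP.coord_g i 0 1)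
  simpa using this

theorem lg_nonneg [NeZero n] (hP : IsProblem h g β L Lg μ) : 0 ≤ Lg := by
  have := (norm_nonneg _).trans (hP.smooth_g (EuclideanSpace.single 0 1) 0)
  simpa using this

theorem mono_zero (hP : IsProblem h g β L Lg μ) (hμ : 0 ≤ μ) : IsProblem h g β L Lg 0 :=
  ⟨hP.diff_h, hP.diff_g, hP.strongConvex.mono hμ, hP.smooth_h, hP.smooth_g, hP.coord_g⟩

theorem lowerQuad (hP : IsProblem h g β L Lg μ) :
    LowerQuad (fun x => h x + g x) (fun x => gradient h x + gradient g x) μ := by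
  have h1 := lowerQuad_of_strongConvex (hP.diff_h.add hP.diff_g) hP.strongConvex
  have h2 : gradient (fun x => h x + g x) = fun x => gradient h x + gradient g x := by
    refine gradient_eq fun x => ?_
    have := ((hP.diff_h x).hasGradientAt.hasFDerivAt).add (hP.diff_g x).hasGradientAt.hasFDerivAt
    rw [hasGradientAt_iff_hasFDerivAt, map_add]
    exact this
  change LowerQuad (fun x => h x + g x) (gradient fun x => h x + g x) μ at h1
  rwa [h2] at h1

theorem upperQuad_h (hP : IsProblem h g β L Lg μ) : UpperQuad h (gradient h) L :=
  upperQuad_of_lipschitz hP.diff_h hP.smooth_h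

theorem upperQuad_g (hP : IsProblem h g β L Lg μ) : UpperQuad g (gradient g) Lg :=
  upperQuad_of_lipschitz hP.diff_g hP.smooth_g

theorem lowerQuad_h (hP : IsProblem h g β L Lg μ) : LowerQuad h (gradient h) (-L) := by
  have hg : gradient (fun x => -h x) = fun x => -gradient h x := by
    refine gradient_eq fun x => ?_
    rw [hasGradientAt_iff_hasFDerivAt, map_neg]
    exact (hP.diff_h x).hasGradientAt.hasFDerivAt.neg
  have h1 : UpperQuad (fun x => -h x) (gradient fun x => -h x) L := by
    refine upperQuad_of_lipschitz hP.diff_h.neg fun x y => ?_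
    rw [hg, neg_sub_neg, norm_sub_rev]
    exact hP.smooth_h x y
  rw [hg] at h1
  simpa using h1.neg

theorem lowerQuad_proxObj (hP : IsProblem h g β L Lg 0) (c : Vec n) :
    LowerQuad (proxObj h g L c) (proxGrad h g L c) L := by
  have := hP.lowerQuad.add (lowerQuad_quadratic L c)
  rwa [zero_add] at this

theorem upperQuad_proxObj (hP : IsProblem h g β L Lg 0) (c : Vec n) :
    UpperQuad (proxObj h g L c) (proxGrad h g L c) (L + Lg + L) :=
  (hP.upperQuad_h.add hP.upperQuad_g).add (upperQuad_quadratic L c)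

/-- Writing `g = (h + g) - h` gives `g` curvature at least `-L`, and the two quadratic terms add `2
* L`. Convexity is only used for the sum. -/
theorem lowerQuad_passObj (hP : IsProblem h g β L Lg 0) (c ζ : Vec n) :
    LowerQuad (passObj h g L c ζ) (passGrad h g L c ζ) L := by
  have := (((hP.lowerQuad.add hP.upperQuad_h.neg).add
    (lowerQuad_affine (h ζ) (gradient h ζ) ζ)).add (lowerQuad_quadratic L c)).add
      (lowerQuad_quadratic L ζ)
  intro x v
  have h1 := this x v
  simp only [passObj, passGrad]
  have h2 : gradient h x + gradient g x + -gradient h x + gradient h ζ + L • (x - c) +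
      L • (x - ζ) = gradient h ζ + gradient g x + L • (x - c) + L • (x - ζ) := by abel
  beta_reduce at h1
  rw [h2] at h1
  linarith

theorem upperQuad_passObj (hP : IsProblem h g β L Lg 0) (c ζ : Vec n) :
    UpperQuad (passObj h g L c ζ) (passGrad h g L c ζ) (L + Lg + L) := by
  have := (((upperQuad_affine (h ζ) (gradient h ζ) ζ).add hP.upperQuad_g).add
    (upperQuad_quadratic L c)).add (upperQuad_quadratic L ζ)
  intro x v
  have h1 := this x v
  simp only [passObj, passGrad]
  linarith

theorem passObj_coord_le (hP : IsProblem h g β L Lg 0) (c ζ : Vec n) (i : Fin n) (x : Vec n)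
    (t : ℝ) : passObj h g L c ζ (x + EuclideanSpace.single i t) ≤
      passObj h g L c ζ x + t * passGrad h g L c ζ x i + (β i + (L + L)) / 2 * t ^ 2 := by
  have h1 := coordinate_upper_bound hP.diff_g (hP.coord_g i) x t
  have h2 := affine_expansion (h ζ) (gradient h ζ) ζ x (x + EuclideanSpace.single i t)
  have h3 := quadratic_expansion L c x (x + EuclideanSpace.single i t)
  have h4 := quadratic_expansion L ζ x (x + EuclideanSpace.single i t)
  simp only [add_sub_cancel_left, EuclideanSpace.inner_single_right, RCLike.conj_to_real,
    PiLp.norm_single, Real.norm_eq_abs, sq_abs] at h2 h3 h4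
  simp only [passObj, passGrad, PiLp.add_apply]
  linarith

theorem exists_min_proxObj (hP : IsProblem h g β L Lg 0) (hL : 0 < L) (c : Vec n) :
    ∃ p, ∀ v, proxObj h g L c p ≤ proxObj h g L c v := by
  refine (hP.lowerQuad_proxObj c).exists_min hL ?_
  have h1 := hP.diff_h.continuous
  have h2 := hP.diff_g.continuous
  unfold proxObj
  fun_prop

theorem exists_min_passObj (hP : IsProblem h g β L Lg 0) (hL : 0 < L) (c ζ : Vec n) :
    ∃ p, ∀ v, passObj h g L c ζ p ≤ passObj h g L c ζ v := by
  refine (hP.lowerQuad_passObj c ζ).exists_min hL ?_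
  have h2 := hP.diff_g.continuous
  unfold passObj
  fun_prop

theorem proxObj_le_passObj (hP : IsProblem h g β L Lg 0) (c ζ v : Vec n) :
    proxObj h g L c v ≤ passObj h g L c ζ v := by
  have := hP.upperQuad_h ζ v
  simp only [proxObj, passObj]
  linarith

theorem passObj_le (hP : IsProblem h g β L Lg 0) (c ζ v : Vec n) :
    passObj h g L c ζ v ≤ proxObj h g L c v + L * ‖v - ζ‖ ^ 2 := by
  have := hP.lowerQuad_h ζ v
  simp only [proxObj, passObj]
  linarith

theorem passObj_self (c ζ : Vec n) : passObj h g L c ζ ζ = proxObj h g L c ζ := by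
  simp [proxObj, passObj]

/-- An exact minimization of the model contracts the suboptimality. -/
theorem passObj_min_le (hP : IsProblem h g β L Lg 0) {c ζ p q : Vec n}
    (hq : ∀ v, passObj h g L c ζ q ≤ passObj h g L c ζ v) :
    passObj h g L c ζ q - proxObj h g L c p ≤
      2 / 3 * (proxObj h g L c ζ - proxObj h g L c p) := by
  -- At the fraction `t` of the segment the model error is at most `L t² ‖p - ζ‖²` and strong
  -- convexity gains `L t (1 - t) / 2 ‖p - ζ‖²`; these cancel for `t = 1/3`.
  set v := ζ + (1 / 3 : ℝ) • (p - ζ) with hv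
  have h1 := (hq v).trans (hP.passObj_le c ζ v)
  have h2 := hP.lowerQuad_proxObj c v ζ
  have h3 := hP.lowerQuad_proxObj c v p
  have e1 : v - ζ = (1 / 3 : ℝ) • (p - ζ) := by rw [hv]; abel
  have e2 : ζ - v = (-(1 / 3) : ℝ) • (p - ζ) := by rw [hv]; module
  have e3 : p - v = (2 / 3 : ℝ) • (p - ζ) := by rw [hv]; module
  rw [e1, norm_smul, mul_pow] at h1
  rw [e2, norm_smul, mul_pow, inner_smul_right] at h2
  rw [e3, norm_smul, mul_pow, inner_smul_right] at h3
  norm_num at h1 h2 h3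
  linarith

end IsProblem

/-! ### Relative suboptimality and the effect of one pass -/

variable {n : ℕ} {h g : Vec n → ℝ} {β : Fin n → ℝ} {L Lg : ℝ}

/-- The suboptimality of `v` in the proximal problem at `c` with solution `p`, relative to the
distance of `c` and `p`. -/
def relGap (h g : Vec n → ℝ) (L : ℝ) (c p v : Vec n) : ℝ :=
  (proxObj h g L c v - proxObj h g L c p) / (L * ‖c - p‖ ^ 2)

section Pass

variable {c p : Vec n}

theorem relGap_denominator_pos (hL : 0 < L) (hcp : c ≠ p) : 0 < L * ‖c - p‖ ^ 2 := by
  have : 0 < ‖c - p‖ := norm_pos_iff.mpr (sub_ne_zero.mpr hcp)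
  positivity

theorem relGap_nonneg (hL : 0 < L) (hcp : c ≠ p)
    (hp : ∀ v, proxObj h g L c p ≤ proxObj h g L c v) (v : Vec n) : 0 ≤ relGap h g L c p v :=
  div_nonneg (sub_nonneg.mpr (hp v)) (relGap_denominator_pos hL hcp).le

variable [NeZero n]

theorem relGap_self_le (hP : IsProblem h g β L Lg 0) (hL : 0 < L) (hcp : c ≠ p)
    (hp : ∀ v, proxObj h g L c p ≤ proxObj h g L c v) :
    relGap h g L c p c ≤ 2 + Lg / L := by
  have hpos := relGap_denominator_pos hL hcp
  rw [relGap, div_le_iff₀ hpos]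
  have hLg := hP.lg_nonneg
  have h0 := (hP.upperQuad_proxObj c).gradient_eq_zero (by positivity) hp
  have h1 := hP.upperQuad_proxObj c p c
  rw [h0, inner_zero_left] at h1
  have h2 : (2 + Lg / L) * (L * ‖c - p‖ ^ 2) = (L + Lg + L) * ‖c - p‖ ^ 2 := by
    field_simp; ring
  rw [h2]
  have : 0 ≤ (L + Lg + L) * ‖c - p‖ ^ 2 := by positivity
  linarith

theorem norm_sub_le_of_relGap_le (hP : IsProblem h g β L Lg 0) (hL : 0 < L) (hcp : c ≠ p)
    (hp : ∀ v, proxObj h g L c p ≤ proxObj h g L c v)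
    {v : Vec n} (hv : relGap h g L c p v ≤ 1 / 800) :
    ‖v - p‖ ≤ ‖c - p‖ / 20 := by
  have hpos := relGap_denominator_pos hL hcp
  rw [relGap, div_le_iff₀ hpos] at hv
  have hLg := hP.lg_nonneg
  have h0 := (hP.upperQuad_proxObj c).gradient_eq_zero (by positivity) hp
  have h1 := hP.lowerQuad_proxObj c p v
  rw [h0, inner_zero_left] at h1
  refine abs_le_of_sq_le_sq' ?_ (by positivity) |>.2
  have h2 : L * ‖v - p‖ ^ 2 ≤ L * (‖c - p‖ / 20) ^ 2 := by linarith
  exact le_of_mul_le_mul_left h2 hL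

/-- The effect of one pass: `w` measures the error of the inner method. -/
theorem exists_pass_error (hP : IsProblem h g β L Lg 0) (hL : 0 < L) (hcp : c ≠ p)
    (hp : ∀ v, proxObj h g L c p ≤ proxObj h g L c v)
    (N : ℕ) (ζ : Vec n) {θ : ℝ}
    (hθ : 2 * (1 - rcdTau β (L + L) L) ^ N ≤ θ) :
    ∃ w : Vec n → ℝ, (∀ v, 0 ≤ w v) ∧
      ((rcdLoop β (L + L) L (gradient h ζ - L • c - L • ζ) N ζ ζ).expect
        (fun x => gradient h x) (fun i x => gradient g x i) fun r => w r.value) ≤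
          θ * relGap h g L c p ζ ∧
      (∀ v, relGap h g L c p v ≤ 2 / 3 * relGap h g L c p ζ + w v) ∧
      (ζ = c → ∀ v, relGap h g L c p v ≤ 1 + w v) ∧
      (∀ v, relGap h g L c p ζ ≤ 1 / 1000 → w v ≤ 1 / (10000 * (2 + Lg / L)) →
        ProxCrit h g L c v) := by
  have hpos := relGap_denominator_pos hL hcp
  have hLg := hP.lg_nonneg
  obtain ⟨q, hq⟩ := hP.exists_min_passObj hL c ζ
  have hq0 := (hP.upperQuad_passObj c ζ).gradient_eq_zero (by positivity) hq
  have hw : ∀ i, 0 < β i + (L + L) := fun i => by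
    have := hP.beta_nonneg i
    positivity
  have hgap : ∀ v, relGap h g L c p v ≤ 2 / 3 * relGap h g L c p ζ +
      (passObj h g L c ζ v - passObj h g L c ζ q) / (L * ‖c - p‖ ^ 2) := by
    intro v
    rw [relGap, relGap, ← mul_div_assoc, ← add_div]
    refine (div_le_div_iff_of_pos_right hpos).mpr ?_
    have h1 := hP.passObj_min_le (p := p) hq
    have h2 := hP.proxObj_le_passObj c ζ v
    linarith
  refine ⟨fun v => (passObj h g L c ζ v - passObj h g L c ζ q) / (L * ‖c - p‖ ^ 2),
    fun v => div_nonneg (sub_nonneg.mpr (hq v)) hpos.le, ?_, hgap, ?_, ?_⟩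
  · have h1 := expect_rcdLoop_gap_le (oh := fun x => gradient h x)
      (og := fun i x => gradient g x i) (b := gradient h ζ - L • c - L • ζ)
      hw hL (fun i x => ?_) (hP.lowerQuad_passObj c ζ) (hP.passObj_coord_le c ζ) hq0 N ζ
    · have h2 := expect_add_const_mul (oh := fun x => gradient h x)
        (og := fun i x => gradient g x i)
        (rcdLoop β (L + L) L (gradient h ζ - L • c - L • ζ) N ζ ζ) 0
        (1 / (L * ‖c - p‖ ^ 2)) fun r => passObj h g L c ζ r.value - passObj h g L c ζ q
      simp only [zero_add, one_div_mul_eq_div] at h2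
      rw [h2, relGap, ← mul_div_assoc]
      refine (div_le_div_iff_of_pos_right hpos).mpr (h1.trans ?_)
      have h3 : passObj h g L c ζ ζ - passObj h g L c ζ q ≤
          proxObj h g L c ζ - proxObj h g L c p := by
        have h4 := hP.proxObj_le_passObj c ζ q
        have h5 := hp q
        rw [IsProblem.passObj_self]
        linarith
      have h6 : 0 ≤ θ := by
        refine le_trans ?_ hθ
        have := (rcdTau_spec hw hL).2.1
        have : 0 ≤ 1 - rcdTau β (L + L) L := by linarith
        positivity
      exact (mul_le_mul_of_nonneg_right hθ (sub_nonneg.mpr (hq ζ))).trans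
        (mul_le_mul_of_nonneg_left h3 h6)
    · simp only [passGrad, PiLp.add_apply, PiLp.sub_apply, PiLp.smul_apply, smul_eq_mul]
      ring
  -- The model minimum is at most the model value at `p`, which exceeds the proximal minimum by at
  -- most `L * ‖c - p‖ ^ 2`. This bound does not see `Lg`, which keeps the number of passes
  -- absolute.
  · rintro rfl v
    have h1 := (hq p).trans (hP.passObj_le ζ ζ p)
    have h2 := hP.proxObj_le_passObj ζ ζ v
    rw [norm_sub_rev] at h1
    dsimp only
    rw [relGap, div_le_iff₀ hpos, add_mul, div_mul_cancel₀ _ hpos.ne']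
    linarith
  -- With `d = ‖c - p‖`, both `ζ` and `v` lie within `d / 20` of `p`. The model gradient at `v` is
  -- at most `L d / 20` and the correction to the proximal gradient at most `L d / 5`, in total `L d
  -- / 4`, while `‖v - c‖ ≥ 19 d / 20`.
  · intro v hζ hv
    have h1 := norm_sub_le_of_relGap_le hP hL hcp hp (hζ.trans (by norm_num))
    have h2 : 1 / (10000 * (2 + Lg / L)) ≤ 1 / 20000 := by
      have : 0 ≤ Lg / L := by positivity
      exact one_div_le_one_div_of_le (by norm_num) (by linarith)
    have h3 := norm_sub_le_of_relGap_le hP hL hcp hp (v := v) (by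
      dsimp only at hv
      linarith [hgap v])
    have h4 : ‖passGrad h g L c ζ v‖ ≤ L * ‖c - p‖ / 20 := by
      refine abs_le_of_sq_le_sq' ?_ (by positivity) |>.2
      refine ((hP.upperQuad_passObj c ζ).norm_sq_le (by positivity) hq v).trans ?_
      dsimp only at hv
      rw [div_le_iff₀ hpos] at hv
      have h5 : 2 * (L + Lg + L) * (passObj h g L c ζ v - passObj h g L c ζ q) ≤
          2 * (L + Lg + L) * (1 / (10000 * (2 + Lg / L)) * (L * ‖c - p‖ ^ 2)) :=
        mul_le_mul_of_nonneg_left hv (by positivity)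
      have h6 : 2 * (L + Lg + L) * (1 / (10000 * (2 + Lg / L)) * (L * ‖c - p‖ ^ 2)) =
          (L * ‖c - p‖) ^ 2 / 5000 := by
        have : 2 + Lg / L = (L + Lg + L) / L := by field_simp; ring
        rw [this]
        have : L + Lg + L ≠ 0 := by positivity
        field_simp
        ring
      rw [h6] at h5
      have : 0 ≤ (L * ‖c - p‖) ^ 2 := sq_nonneg _
      linarith
    have h5 : proxGrad h g L c v =
        passGrad h g L c ζ v + ((gradient h v - gradient h ζ) - L • (v - ζ)) := by
      simp only [proxGrad, passGrad]; abel
    have h6 : ‖v - ζ‖ ≤ ‖c - p‖ / 10 := by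
      have : v - ζ = (v - p) - (ζ - p) := by abel
      rw [this]
      linarith [norm_sub_le (v - p) (ζ - p)]
    have h7 : ‖(gradient h v - gradient h ζ) - L • (v - ζ)‖ ≤ L * ‖c - p‖ / 5 := by
      have h8 := norm_sub_le (gradient h v - gradient h ζ) (L • (v - ζ))
      rw [norm_smul, Real.norm_of_nonneg hL.le] at h8
      have h9 := hP.smooth_h v ζ
      have h10 := mul_le_mul_of_nonneg_left h6 hL.le
      linarith
    have h8 : ‖c - p‖ - ‖c - p‖ / 20 ≤ ‖v - c‖ := by
      have : c - p = (v - p) - (v - c) := by abel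
      have h9 := norm_sub_le (v - p) (v - c)
      rw [← this] at h9
      linarith
    rw [ProxCrit, h5]
    have h9 := norm_add_le (passGrad h g L c ζ v)
      ((gradient h v - gradient h ζ) - L • (v - ζ))
    have h10 := mul_le_mul_of_nonneg_left h8 hL.le
    have h11 : 0 < L * ‖c - p‖ := mul_pos hL (norm_pos_iff.mpr (sub_ne_zero.mpr hcp))
    linarith

end Pass

end OracleSep

namespace OracleSep

open OracleProg

variable {n : ℕ} [NeZero n] {h g : Vec n → ℝ} {β : Fin n → ℝ} {L Lg : ℝ}

/-! ### The number of passes of the gradient method for composite optimization -/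

section Passes

variable {N K : ℕ}

open Classical in
-- The inner method makes no `h`-call and each pass makes exactly one, so `hCalls` counts passes.
theorem expect_gmcoLoop_succ (c ζ : Vec n) (k : ℕ) (Ψ : ℕ → ℝ) :
    ((gmcoLoop ⟨β, L, L, N, K⟩ c (k + 1) ζ (gradient h ζ)).expect
      (fun x => gradient h x) (fun i x => gradient g x i) fun r => Ψ r.hCalls) =
    (rcdLoop β (L + L) L (gradient h ζ - L • c - L • ζ) N ζ ζ).expect
      (fun x => gradient h x) (fun i x => gradient g x i) fun r =>
        if ProxCrit h g L c r.value then Ψ 1 else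
          (gmcoLoop ⟨β, L, L, N, K⟩ c k r.value (gradient h r.value)).expect
            (fun x => gradient h x) (fun i x => gradient g x i) fun r' => Ψ (r'.hCalls + 1) := by
  rw [gmcoLoop, expect_bind]
  refine expect_congr_of_sure ((sure_rcdLoop _ _ _ _ _ _ _).imp fun r hr => ?_)
  rw [expect_bind, expect_askGradH, expect_bind,
    expect_askGradG (dg := fun x => gradient g x) fun i x => rfl]
  simp only [Outcome.after, hr.1, zero_add]
  by_cases hc : ProxCrit h g L c r.value
  · have hc' : ‖gradient h r.value + gradient g r.value + L • (r.value - c)‖ ≤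
        L / 2 * ‖r.value - c‖ := hc
    rw [if_pos hc, if_pos hc']
    rfl
  · have hc' : ¬‖gradient h r.value + gradient g r.value + L • (r.value - c)‖ ≤
        L / 2 * ‖r.value - c‖ := hc
    rw [if_neg hc, if_neg hc']
    simp only [add_comm 1]

theorem sure_gmcoLoop (c : Vec n) (k : ℕ) (ζ dh : Vec n) :
    (gmcoLoop ⟨β, L, L, N, K⟩ c k ζ dh).Sure
      (fun x => gradient h x) (fun i x => gradient g x i) fun r =>
        (ProxCrit h g L c r.value ∨ k ≤ r.hCalls) ∧ r.gCalls ≤ (N + n) * r.hCalls := by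
  induction k generalizing ζ dh with
  | zero => simp [gmcoLoop]
  | succ k ih =>
    rw [gmcoLoop]
    apply sure_bind
    refine (sure_rcdLoop _ _ _ _ _ _ _).imp fun r hr => ?_
    apply sure_bind
    rw [sure_askGradH]
    apply sure_bind
    refine (askGradG_outcome (dg := fun x => gradient g x) (fun i x => rfl) _).imp fun r' hr' => ?_
    rw [hr']
    split_ifs with hc
    · rw [sure_pure]
      simp only [Outcome.after, hr.2]
      refine ⟨Or.inl hc, ?_⟩
      simp [hr.1]
    · refine (ih _ _).imp fun r'' hr'' => ?_
      simp only [Outcome.after, hr.2, hr.1]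
      refine ⟨hr''.1.imp id fun _ => by omega, ?_⟩
      have := hr''.2
      ring_nf at this ⊢
      omega

variable {c p : Vec n} {θ : ℝ}

/-- The expected number of passes from any point. -/
theorem expect_passes_le (hP : IsProblem h g β L Lg 0) (hL : 0 < L) (hcp : c ≠ p)
    (hp : ∀ v, proxObj h g L c p ≤ proxObj h g L c v)
    (hN : 2 * (1 - rcdTau β (L + L) L) ^ N ≤ θ) (hθ : θ ≤ 1 / (10000 * (2 + Lg / L)))
    (k : ℕ) (ζ : Vec n) :
    ((gmcoLoop ⟨β, L, L, N, K⟩ c k ζ (gradient h ζ)).expect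
      (fun x => gradient h x) (fun i x => gradient g x i) fun r => (r.hCalls : ℝ)) ≤
    20000 * relGap h g L c p ζ + 2 := by
  classical
  have hκ : 0 ≤ Lg / L := div_nonneg hP.lg_nonneg hL.le
  set γ := 1 / (10000 * (2 + Lg / L)) with hγ
  have hγ0 : 0 < γ := by positivity
  have hγ1 : γ ≤ 1 / 20000 := one_div_le_one_div_of_le (by norm_num) (by linarith)
  induction k generalizing ζ with
  | zero =>
    have := relGap_nonneg hL hcp hp ζ
    simp only [gmcoLoop, expect_pure, Nat.cast_zero]
    positivity
  | succ k ih =>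
    rw [expect_gmcoLoop_succ c ζ k fun m => (m : ℝ)]
    obtain ⟨w, hw0, hwE, hwu, -, hwc⟩ := exists_pass_error hP hL hcp hp N ζ hN
    set u := relGap h g L c p ζ
    have hu : 0 ≤ u := relGap_nonneg hL hcp hp ζ
    have hrec : ∀ v : Vec n, ((gmcoLoop ⟨β, L, L, N, K⟩ c k v (gradient h v)).expect
        (fun x => gradient h x) (fun i x => gradient g x i) fun r' => ((r'.hCalls + 1 : ℕ) : ℝ)) ≤
        20000 * (2 / 3 * u + w v) + 3 := by
      intro v
      have h1 := expect_add_const_mul (oh := fun x => gradient h x)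
        (og := fun i x => gradient g x i)
        (gmcoLoop ⟨β, L, L, N, K⟩ c k v (gradient h v)) 1 1 fun r => (r.hCalls : ℝ)
      simp only [Nat.cast_add, Nat.cast_one, one_mul, add_comm _ (1 : ℝ)] at h1 ⊢
      rw [h1]
      linarith [ih v, hwu v]
    -- For `u ≤ 1 / 1000` the loop goes on only if `w > γ`, and the cost of this is charged to `w /
    -- γ`, of mean at most `u`. For larger `u` the contraction of `20000 * u` pays for the pass.
    rcases le_total u (1 / 1000) with hs | hs
    · refine (expect_mono _ (Φ := fun r => (1 + 20000 * (2 / 3 * u)) +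
        (20000 + 2 / γ) * w r.value) fun r => ?_).trans ?_
      · have hwr := hw0 r.value
        have h2 : 0 ≤ 2 / γ * w r.value := by positivity
        split_ifs with hc
        · push_cast
          linarith
        · have h3 : γ < w r.value := not_le.mp fun hle => hc (hwc _ hs hle)
          have h4 : 2 ≤ 2 / γ * w r.value := by
            rw [div_mul_eq_mul_div, le_div_iff₀ hγ0]
            linarith
          linarith [hrec r.value]
      · rw [expect_add_const_mul]
        have h5 : (20000 + 2 / γ) * (θ * u) ≤ 20001 * u / 10000 + 1 := by
          have e1 : (20000 + 2 / γ) * (γ * u) = 20000 * γ * u + 2 * u := by field_simp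
          have e2 : (20000 + 2 / γ) * (θ * u) ≤ (20000 + 2 / γ) * (γ * u) := by gcongr
          have e3 : γ * u ≤ 1 / 20000 * u := by gcongr
          linarith
        have h6 : (20000 + 2 / γ) * (rcdLoop β (L + L) L (gradient h ζ - L • c - L • ζ) N ζ ζ).expect
            (fun x => gradient h x) (fun i x => gradient g x i) (fun r => w r.value) ≤
            (20000 + 2 / γ) * (θ * u) := by gcongr
        linarith
    · refine (expect_mono _ (Φ := fun r => (3 + 20000 * (2 / 3 * u)) +
        20000 * w r.value) fun r => ?_).trans ?_
      · have hwr := hw0 r.value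
        split_ifs with hc
        · push_cast
          linarith
        · linarith [hrec r.value]
      · rw [expect_add_const_mul]
        have h3 : θ * u ≤ 1 / 20000 * u := by gcongr; linarith
        linarith

/-- One pass of the bound on the expected number of passes beyond a given number. -/
theorem expect_excess_succ_le (hP : IsProblem h g β L Lg 0) (hL : 0 < L) (hcp : c ≠ p)
    (hp : ∀ v, proxObj h g L c p ≤ proxObj h g L c v)
    (hN : 2 * (1 - rcdTau β (L + L) L) ^ N ≤ θ) (hθ : θ ≤ 1 / (10000 * (2 + Lg / L)))
    (k j : ℕ) (ζ : Vec n) (hζ : relGap h g L c p ζ ≤ 2 + Lg / L) {B : ℝ} (hB : 0 ≤ B)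
    (hgood : ∀ v, ¬ProxCrit h g L c v →
      ¬relGap h g L c p ζ ≤ 1 / 1000 →
      relGap h g L c p v ≤ 2 / 3 * relGap h g L c p ζ + 1 / 20000 →
      (ζ = c → relGap h g L c p v ≤ 1 + 1 / 20000) →
      ((gmcoLoop ⟨β, L, L, N, K⟩ c k v (gradient h v)).expect
        (fun x => gradient h x) (fun i x => gradient g x i)
          fun r => ((r.hCalls - j : ℕ) : ℝ)) ≤ B) :
    ((gmcoLoop ⟨β, L, L, N, K⟩ c (k + 1) ζ (gradient h ζ)).expect
      (fun x => gradient h x) (fun i x => gradient g x i)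
        fun r => ((r.hCalls - (j + 1) : ℕ) : ℝ)) ≤ B + 10 ^ 9 * (2 + Lg / L) ^ 3 * θ := by
  classical
  have hκ : 0 ≤ Lg / L := div_nonneg hP.lg_nonneg hL.le
  set κ := 2 + Lg / L with hκdef
  have hκ2 : 2 ≤ κ := by linarith
  set γ := 1 / (10000 * κ) with hγ
  have hγ0 : 0 < γ := by positivity
  have hγ1 : γ ≤ 1 / 20000 := one_div_le_one_div_of_le (by norm_num) (by linarith)
  rw [expect_gmcoLoop_succ c ζ k fun m => ((m - (j + 1) : ℕ) : ℝ)]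
  obtain ⟨w, hw0, hwE, hwu, hwc', hwc⟩ := exists_pass_error hP hL hcp hp N ζ hN
  set u := relGap h g L c p ζ
  have hu : 0 ≤ u := relGap_nonneg hL hcp hp ζ
  have hθ0 : 0 ≤ θ := by
    refine le_trans ?_ hN
    have hw : ∀ i, 0 < β i + (L + L) := fun i => by
      have := hP.beta_nonneg i
      positivity
    have := (rcdTau_spec hw hL).2.1
    have : 0 ≤ 1 - rcdTau β (L + L) L := by linarith
    positivity
  have hcoef : 0 ≤ 20000 + (20000 * κ + 2) / γ := by positivity
  refine (expect_mono _ (Φ := fun r => B + (20000 + (20000 * κ + 2) / γ) * w r.value)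
    fun r => ?_).trans ?_
  · have hwr := hw0 r.value
    have h0 : 0 ≤ (20000 + (20000 * κ + 2) / γ) * w r.value := mul_nonneg hcoef hwr
    split_ifs with hc
    · simp only [Nat.sub_eq_zero_of_le (Nat.le_add_left 1 j), Nat.cast_zero]
      linarith
    · simp only [Nat.add_sub_add_right]
      rcases le_or_gt (w r.value) γ with hle | hgt
      · refine (hgood r.value hc (fun hs => hc (hwc _ hs hle)) ?_ fun hcz => ?_).trans
          (by linarith)
        · linarith [hwu r.value]
        · linarith [hwc' hcz r.value]
      -- After a bad pass the crude bound on all remaining passes is used; its constant part is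
      -- charged to `w / γ > 1`.
      · have h1 := expect_passes_le (K := K) hP hL hcp hp hN hθ k r.value
        have h2 : ((gmcoLoop ⟨β, L, L, N, K⟩ c k r.value (gradient h r.value)).expect
            (fun x => gradient h x) (fun i x => gradient g x i)
              fun r => ((r.hCalls - j : ℕ) : ℝ)) ≤ _ :=
          (expect_mono _ fun r => Nat.cast_le.mpr (Nat.sub_le _ _)).trans h1
        have h3 : 20000 * κ + 2 ≤ (20000 * κ + 2) / γ * w r.value := by
          rw [div_mul_eq_mul_div, le_div_iff₀ hγ0]
          exact mul_le_mul_of_nonneg_left hgt.le (by positivity)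
        linarith [hwu r.value]
  · rw [expect_add_const_mul]
    have h1 : (20000 + (20000 * κ + 2) / γ) *
        (rcdLoop β (L + L) L (gradient h ζ - L • c - L • ζ) N ζ ζ).expect
          (fun x => gradient h x) (fun i x => gradient g x i) (fun r => w r.value) ≤
        (20000 + (20000 * κ + 2) / γ) * (θ * κ) := by
      gcongr
      exact hwE.trans (mul_le_mul_of_nonneg_left hζ hθ0)
    -- The three factors `κ` come from the cost of a bad pass, from `1 / γ`, and from the mean `θ *
    -- κ` of the error.
    have h2 : (20000 + (20000 * κ + 2) / γ) * (θ * κ) =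
        (20000 * κ + 200000000 * κ ^ 3 + 20000 * κ ^ 2) * θ := by
      rw [hγ]; field_simp; ring
    have h3 : 20000 * κ + 200000000 * κ ^ 3 + 20000 * κ ^ 2 ≤ 10 ^ 9 * κ ^ 3 := by
      have e1 : κ ^ 2 ≤ κ ^ 3 := pow_le_pow_right₀ (by linarith) (by norm_num)
      have e2 : κ ^ 1 ≤ κ ^ 3 := pow_le_pow_right₀ (by linarith) (by norm_num)
      have e3 : 0 ≤ κ ^ 3 := by positivity
      linarith
    have h4 := mul_le_mul_of_nonneg_right h3 hθ0
    linarith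

/-- Above the level `1 / 1000` the error `1 / 20000` is below `u / 12`, so a good pass contracts the
gap by `2/3 + 1/12 = 3/4`. Thus `j` good passes reach the level and one more stops the loop. -/
theorem expect_excess_le (hP : IsProblem h g β L Lg 0) (hL : 0 < L) (hcp : c ≠ p)
    (hp : ∀ v, proxObj h g L c p ≤ proxObj h g L c v)
    (hN : 2 * (1 - rcdTau β (L + L) L) ^ N ≤ θ) (hθ : θ ≤ 1 / (10000 * (2 + Lg / L)))
    (j k : ℕ) (ζ : Vec n) (hζ : relGap h g L c p ζ ≤ 2 + Lg / L)
    (hj : relGap h g L c p ζ ≤ 1 / 1000 * (4 / 3) ^ j) :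
    ((gmcoLoop ⟨β, L, L, N, K⟩ c k ζ (gradient h ζ)).expect
      (fun x => gradient h x) (fun i x => gradient g x i)
        fun r => ((r.hCalls - (j + 1) : ℕ) : ℝ)) ≤ (j + 1) * (10 ^ 9 * (2 + Lg / L) ^ 3 * θ) := by
  have hκ : 0 ≤ Lg / L := div_nonneg hP.lg_nonneg hL.le
  have hθ0 : 0 ≤ θ := by
    refine le_trans ?_ hN
    have hw : ∀ i, 0 < β i + (L + L) := fun i => by
      have := hP.beta_nonneg i
      positivity
    have := (rcdTau_spec hw hL).2.1
    have : 0 ≤ 1 - rcdTau β (L + L) L := by linarith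
    positivity
  have hpos : 0 ≤ 10 ^ 9 * (2 + Lg / L) ^ 3 * θ := by positivity
  induction j generalizing k ζ with
  | zero =>
    rcases k with _ | k
    · simpa [gmcoLoop] using hpos
    · have := expect_excess_succ_le (K := K) hP hL hcp hp hN hθ k 0 ζ hζ le_rfl
        fun v _ hs _ _ => (hs (by simpa using hj)).elim
      simpa using this
  | succ j ih =>
    rcases k with _ | k
    · simp only [gmcoLoop, expect_pure, Nat.zero_sub, Nat.cast_zero]
      positivity
    · have hB : 0 ≤ ((j : ℝ) + 1) * (10 ^ 9 * (2 + Lg / L) ^ 3 * θ) := by positivity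
      have := expect_excess_succ_le (K := K) hP hL hcp hp hN hθ k (j + 1) ζ hζ hB
        fun v _ hs hv _ => ?_
      · refine this.trans_eq ?_
        push_cast
        ring
      · have hs' : 1 / 1000 < relGap h g L c p ζ := not_le.mp hs
        rw [pow_succ] at hj
        exact ih k v (by linarith) (by linarith)

/-- A good first pass leaves a gap of at most `1 + 1 / 20000`, which is below `(4 / 3) ^ 27 / 1000`;
`28` further passes then suffice. -/
theorem expect_excess_center_le (hP : IsProblem h g β L Lg 0) (hL : 0 < L)
    (hN : 2 * (1 - rcdTau β (L + L) L) ^ N ≤ θ) (hθ : θ ≤ 1 / (10000 * (2 + Lg / L)))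
    (c : Vec n) (k : ℕ) :
    ((gmcoLoop ⟨β, L, L, N, K⟩ c k c (gradient h c)).expect
      (fun x => gradient h x) (fun i x => gradient g x i)
        fun r => ((r.hCalls - 29 : ℕ) : ℝ)) ≤ 29 * (10 ^ 9 * (2 + Lg / L) ^ 3 * θ) := by
  classical
  have hκ : 0 ≤ Lg / L := div_nonneg hP.lg_nonneg hL.le
  have hw : ∀ i, 0 < β i + (L + L) := fun i => by
    have := hP.beta_nonneg i
    positivity
  have hθ0 : 0 ≤ θ := by
    refine le_trans ?_ hN
    have := (rcdTau_spec hw hL).2.1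
    have : 0 ≤ 1 - rcdTau β (L + L) L := by linarith
    positivity
  have hpos : 0 ≤ 10 ^ 9 * (2 + Lg / L) ^ 3 * θ := by positivity
  rcases k with _ | k
  · simp only [gmcoLoop, expect_pure, Nat.zero_sub, Nat.cast_zero]
    positivity
  obtain ⟨p, hp⟩ := hP.exists_min_proxObj hL c
  by_cases hcp : c = p
  -- The centre is the proximal point: the inner method never leaves it and the criterion reads `0 ≤
  -- 0`, so there is a single pass.
  · subst hcp
    have hg0 := (hP.upperQuad_proxObj c).gradient_eq_zero
      (by have := hP.lg_nonneg; positivity) hp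
    rw [expect_gmcoLoop_succ c c k fun m => ((m - 29 : ℕ) : ℝ)]
    have hstay := sure_rcdLoop_of_critical (oh := fun x => gradient h x)
      (og := fun i x => gradient g x i) (b := gradient h c - L • c - L • c)
      (G := passGrad h g L c c) (p := c) hw hL (fun i x => by
        simp only [passGrad, PiLp.add_apply, PiLp.sub_apply, PiLp.smul_apply, smul_eq_mul]
        ring) (by simpa [proxGrad, passGrad] using hg0) N
    rw [expect_congr_of_sure (Φ := fun _ => 0 + 0 * 0) (hstay.imp fun r hr => ?_),
      expect_add_const_mul]
    · simpa using hpos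
    · rw [hr, if_pos (by rw [ProxCrit, hg0]; simp)]
      norm_num
  · have h1 := relGap_self_le hP hL hcp hp
    have := expect_excess_succ_le (K := K) hP hL hcp hp hN hθ k 28 c h1
      (B := 28 * (10 ^ 9 * (2 + Lg / L) ^ 3 * θ)) (by positivity)
      fun v _ _ _ hv => ?_
    · refine this.trans_eq ?_
      ring
    · have hv' := hv rfl
      have h2 := expect_excess_le (K := K) hP hL hcp hp hN hθ 27 k v (by linarith)
        (hv'.trans (by norm_num))
      refine h2.trans_eq ?_
      norm_num

end Passes

end OracleSep

namespace OracleSep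

open OracleProg

variable {n : ℕ} {h g : Vec n → ℝ} {β : Fin n → ℝ} {L Lg μ : ℝ} {N K : ℕ}

/-! ### The Monteiro–Svaiter method -/

/-- The step `a` is the positive root of `L * a ^ 2 = A + a`, and `√A` grows by at least `1 / (2 *
√L)` per iteration, which yields the accelerated rate. -/
theorem msStep_coefficient {A a : ℝ} (hL : 0 < L) (hA : 0 ≤ A)
    (ha : a = (1 / L + √(1 / L ^ 2 + 4 * A / L)) / 2) :
    0 < a ∧ L * a ^ 2 = A + a ∧ √A + 1 / (2 * √L) ≤ √(A + a) := by
  have h1 : 0 ≤ 1 / L ^ 2 + 4 * A / L := by positivity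
  have ha0 : 0 < a := by rw [ha]; positivity
  have h2 : L * a ^ 2 = A + a := by
    have h3 : (2 * a - 1 / L) ^ 2 = 1 / L ^ 2 + 4 * A / L := by
      rw [← Real.sq_sqrt h1]
      congr 1
      linarith
    field_simp at h3
    exact mul_left_cancel₀ hL.ne' (by linear_combination h3 / 4)
  refine ⟨ha0, h2, ?_⟩
  refine Real.le_sqrt_of_sq_le ?_
  have hs : 0 < √L := Real.sqrt_pos.mpr hL
  have h4 : √A / √L + 1 / (2 * L) ≤ a := by
    have h5 : 2 * √A / √L ≤ √(1 / L ^ 2 + 4 * A / L) := by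
      refine Real.le_sqrt_of_sq_le ?_
      rw [div_pow, mul_pow, Real.sq_sqrt hA, Real.sq_sqrt hL.le]
      have : 0 < 1 / L ^ 2 := by positivity
      rw [show (2 : ℝ) ^ 2 = 4 by norm_num]
      linarith
    have h6 : 1 / (2 * L) = 1 / L / 2 := by field_simp
    rw [ha, h6]
    rw [mul_div_assoc] at h5
    linarith
  have h7 : (√A + 1 / (2 * √L)) ^ 2 = A + √A / √L + 1 / (4 * L) := by
    have e1 : (1 / (2 * √L)) ^ 2 = 1 / (4 * L) := by
      rw [div_pow, mul_pow, Real.sq_sqrt hL.le]; norm_num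
    have e2 : 2 * √A * (1 / (2 * √L)) = √A / √L := by field_simp
    rw [add_sq, e1, e2, Real.sq_sqrt hA]
  have h8 : 1 / (4 * L) ≤ 1 / (2 * L) :=
    one_div_le_one_div_of_le (by positivity) (by linarith)
  linarith

/-- The potential of the Monteiro–Svaiter method does not increase. -/
theorem msStep_potential_le (hP : IsProblem h g β L Lg 0) (hL : 0 < L) {A a : ℝ} (hA : 0 ≤ A)
    (ha0 : 0 < a) (ha : L * a ^ 2 = A + a) {x y y' z q : Vec n}
    (hx : x = (A / (A + a)) • y + (a / (A + a)) • z) (hy' : ProxCrit h g L x y') :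
    (A + a) * (h y' + g y' - (h q + g q)) +
      ‖z - a • (gradient h y' + gradient g y') - q‖ ^ 2 / 2 ≤
      A * (h y + g y - (h q + g q)) + ‖z - q‖ ^ 2 / 2 := by
  set G := gradient h y' + gradient g y' with hG
  have h1 := hP.lowerQuad y' y
  have h2 := hP.lowerQuad y' q
  simp only [← hG, zero_div, zero_mul, add_zero] at h1 h2
  have hAa : 0 < A + a := by positivity
  have h3 : a * inner ℝ G (z - q) =
      (A + a) * inner ℝ G (x - y') - A * inner ℝ G (y - y') - a * inner ℝ G (q - y') := by
    rw [← real_inner_smul_right, ← real_inner_smul_right, ← real_inner_smul_right,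
      ← real_inner_smul_right, ← inner_sub_right, ← inner_sub_right]
    congr 1
    have e : (A + a) • x = A • y + a • z := by
      rw [hx, smul_add, smul_smul, smul_smul, mul_div_cancel₀ _ hAa.ne',
        mul_div_cancel₀ _ hAa.ne']
    rw [smul_sub (A + a), e]
    module
  have h4 : ‖z - a • G - q‖ ^ 2 = ‖z - q‖ ^ 2 - 2 * (a * inner ℝ G (z - q)) + a ^ 2 * ‖G‖ ^ 2 := by
    have e : z - a • G - q = (z - q) - a • G := by abel
    rw [e, norm_sub_sq_real, real_inner_smul_right, real_inner_comm, norm_smul, mul_pow,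
      Real.norm_eq_abs, sq_abs]
  -- The squared stopping criterion, expanded; its right side is dominated by the term `(L * ‖y' -
  -- x‖) ^ 2` on the left.
  have h5 : ‖G‖ ^ 2 ≤ 2 * L * inner ℝ G (x - y') := by
    have hc : ‖G + L • (y' - x)‖ ≤ L / 2 * ‖y' - x‖ := hy'
    have hc2 : ‖G + L • (y' - x)‖ ^ 2 ≤ (L / 2 * ‖y' - x‖) ^ 2 := by gcongr
    rw [norm_add_sq_real, real_inner_smul_right, norm_smul, Real.norm_of_nonneg hL.le] at hc2
    have e : inner ℝ G (x - y') = -inner ℝ G (y' - x) := by rw [← inner_neg_right, neg_sub]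
    rw [e]
    have : 0 ≤ (L * ‖y' - x‖) ^ 2 := sq_nonneg _
    linarith
  have h6 : a ^ 2 * ‖G‖ ^ 2 ≤ 2 * ((A + a) * inner ℝ G (x - y')) := by
    have := mul_le_mul_of_nonneg_left h5 (sq_nonneg a)
    rw [← ha]
    linarith
  rw [h4, h3]
  have h7 := mul_le_mul_of_nonneg_left h1 hA
  have h8 := mul_le_mul_of_nonneg_left h2 ha0.le
  linarith

variable [NeZero n]

theorem sure_gmco (c : Vec n) :
    (gmco ⟨β, L, L, N, K⟩ c).Sure (fun x => gradient h x) (fun i x => gradient g x i) fun r =>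
      (ProxCrit h g L c r.value ∨ K ≤ r.hCalls) ∧ r.gCalls ≤ (N + n) * r.hCalls := by
  rw [gmco]
  apply sure_bind
  rw [sure_askGradH]
  refine (sure_gmcoLoop c _ _ _).imp fun r hr => ?_
  simp only [Outcome.after, zero_add]
  refine ⟨hr.1.imp id fun (hk : K ≤ r.hCalls) => by omega, hr.2.trans ?_⟩
  exact Nat.mul_le_mul_left _ (by omega)

theorem sure_msLoop (hP : IsProblem h g β L Lg 0) (hL : 0 < L) {q : Vec n}
    (hq : ∀ x, h q + g q ≤ h x + g x) (m : ℕ) (A : ℝ) (hA : 0 ≤ A) (y z : Vec n) :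
    (msLoop ⟨β, L, L, N, K⟩ m A y z).Sure
      (fun x => gradient h x) (fun i x => gradient g x i) fun r =>
        (K ≤ r.hCalls ∨ (√A + m / (2 * √L)) ^ 2 * (h r.value + g r.value - (h q + g q)) ≤
          A * (h y + g y - (h q + g q)) + ‖z - q‖ ^ 2 / 2) ∧
        r.gCalls ≤ (N + n) * r.hCalls := by
  induction m generalizing A y z with
  | zero =>
    simp only [msLoop, sure_pure, Nat.cast_zero, zero_div, add_zero, Real.sq_sqrt hA, mul_zero,
      le_refl, and_true]
    right
    have : 0 ≤ ‖z - q‖ ^ 2 / 2 := by positivity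
    linarith
  | succ m ih =>
    obtain ⟨ha0, ha, hroot⟩ := msStep_coefficient hL hA rfl
    rw [msLoop]
    apply sure_bind
    refine (sure_gmco _).imp fun r hr => ?_
    apply sure_bind
    rw [sure_askGradH]
    apply sure_bind
    refine (askGradG_outcome (dg := fun x => gradient g x) (fun i x => rfl) _).imp fun r' hr' => ?_
    rw [hr']
    refine (ih _ (by positivity) _ _).imp fun r'' hr'' => ?_
    simp only [Outcome.after, zero_add] at hr'' ⊢
    refine ⟨?_, ?_⟩
    · rcases hr.1 with hc | hk
      · refine hr''.1.imp (fun _ => by omega) fun hle => ?_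
        refine le_trans ?_ (hle.trans (msStep_potential_le hP hL hA ha0 ha rfl hc))
        refine mul_le_mul_of_nonneg_right ?_ (sub_nonneg.mpr (hq _))
        refine pow_le_pow_left₀ (by positivity) ?_ 2
        refine le_trans (le_of_eq ?_) (add_le_add_left hroot _)
        push_cast
        ring
      · left; omega
    · have h1 := hr.2
      have h2 := hr''.2
      have h3 : n ≤ N + n := Nat.le_add_left n N
      ring_nf at h1 h2 ⊢
      omega

/-- Per iteration `30` calls are allotted to the middle loop and one to the gradient at `y'`.
Truncated excess is subadditive, so the conditional expectations simply add up. -/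
theorem expect_msLoop_excess_le {ρ : ℝ}
    (hρ : ∀ c, ((gmco ⟨β, L, L, N, K⟩ c).expect
      (fun x => gradient h x) (fun i x => gradient g x i)
        fun r => ((r.hCalls - 30 : ℕ) : ℝ)) ≤ ρ) (m : ℕ) (A : ℝ) (y z : Vec n) :
    ((msLoop ⟨β, L, L, N, K⟩ m A y z).expect
      (fun x => gradient h x) (fun i x => gradient g x i)
        fun r => ((r.hCalls - 31 * m : ℕ) : ℝ)) ≤ m * ρ := by
  induction m generalizing A y z with
  | zero => simp [msLoop]
  | succ m ih =>
    rw [msLoop, expect_bind]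
    refine (expect_mono _
      (Φ := fun r => m * ρ + 1 * ((r.hCalls - 30 : ℕ) : ℝ)) fun r => ?_).trans ?_
    · rw [expect_bind, expect_askGradH, expect_bind,
        expect_askGradG (dg := fun x => gradient g x) fun i x => rfl]
      simp only [Outcome.after]
      refine (expect_mono _ (Φ := fun r' =>
        ((r.hCalls - 30 : ℕ) : ℝ) + 1 * ((r'.hCalls - 31 * m : ℕ) : ℝ)) fun r' => ?_).trans ?_
      · rw [one_mul, ← Nat.cast_add, Nat.cast_le]
        omega
      · rw [expect_add_const_mul]
        linarith [ih (A + (1 / L + √(1 / L ^ 2 + 4 * A / L)) / 2) r.value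
          (z - ((1 / L + √(1 / L ^ 2 + 4 * A / L)) / 2) •
            (gradient h r.value + gradient g r.value))]
    · rw [expect_add_const_mul]
      push_cast
      linarith [hρ ((A / (A + (1 / L + √(1 / L ^ 2 + 4 * A / L)) / 2)) • y +
        ((1 / L + √(1 / L ^ 2 + 4 * A / L)) / 2 /
          (A + (1 / L + √(1 / L ^ 2 + 4 * A / L)) / 2)) • z)]

theorem sure_ms (hP : IsProblem h g β L Lg 0) (hL : 0 < L) {q : Vec n}
    (hq : ∀ x, h q + g q ≤ h x + g x) (m : ℕ) (x₀ : Vec n) :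
    (ms ⟨β, L, L, N, K⟩ m x₀).Sure (fun x => gradient h x) (fun i x => gradient g x i) fun r =>
        (K ≤ r.hCalls ∨
          (m : ℝ) ^ 2 * (h r.value + g r.value - (h q + g q)) ≤ 2 * L * ‖x₀ - q‖ ^ 2) ∧
        r.gCalls ≤ (N + n) * r.hCalls := by
  refine (sure_msLoop hP hL hq m 0 le_rfl x₀ x₀).imp fun r hr => ⟨hr.1.imp id fun hle => ?_, hr.2⟩
  rw [Real.sqrt_zero, zero_add, zero_mul, zero_add, div_pow, mul_pow, Real.sq_sqrt hL.le,
    div_mul_eq_mul_div, div_le_iff₀ (by positivity)] at hle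
  linarith

/-! ### Restarts -/

/-- With `8 * L ≤ μ * m ^ 2` one run turns a squared distance `s` into a gap `μ * s / 4`, and strong
convexity turns this into a squared distance `s / 2`. -/
theorem sure_restartedMS (hP : IsProblem h g β L Lg μ) (hL : 0 < L) (hμ : 0 < μ) {q : Vec n}
    (hq : ∀ x, h q + g q ≤ h x + g x) {m : ℕ} (hm : 8 * L ≤ μ * (m : ℝ) ^ 2) (t : ℕ)
    (x₀ : Vec n) (s : ℝ) (hs : ‖x₀ - q‖ ^ 2 ≤ s) :
    (restartedMS ⟨β, L, L, N, K⟩ m (t + 1) x₀).Sure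
      (fun x => gradient h x) (fun i x => gradient g x i) fun r =>
        (K ≤ r.hCalls ∨ h r.value + g r.value - (h q + g q) ≤ μ * s / 4 / 2 ^ t) ∧
        r.gCalls ≤ (N + n) * r.hCalls := by
  have hgap : ∀ (x v : Vec n) (s : ℝ), ‖x - q‖ ^ 2 ≤ s →
      (m : ℝ) ^ 2 * (h v + g v - (h q + g q)) ≤ 2 * L * ‖x - q‖ ^ 2 →
      h v + g v - (h q + g q) ≤ μ * s / 4 := by
    intro x v s hx hv
    have h1 : 0 ≤ h v + g v - (h q + g q) := sub_nonneg.mpr (hq v)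
    have h2 := mul_le_mul_of_nonneg_right hm h1
    have h3 := mul_le_mul_of_nonneg_left hv hμ.le
    have h4 := mul_le_mul_of_nonneg_left hx (mul_pos (mul_pos two_pos hL) hμ).le
    have h5 : (8 * L) * (h v + g v - (h q + g q)) ≤ (8 * L) * (μ * s / 4) := by linarith
    exact le_of_mul_le_mul_left h5 (by positivity)
  induction t generalizing x₀ s with
  | zero =>
    rw [restartedMS]
    apply sure_bind
    refine (sure_ms (hP.mono_zero hμ.le) hL hq m x₀).imp fun r hr => ?_
    simp only [restartedMS, sure_pure, Outcome.after, add_zero, pow_zero, div_one]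
    exact ⟨hr.1.imp id (hgap _ _ _ hs), hr.2⟩
  | succ t ih =>
    rw [restartedMS]
    apply sure_bind
    refine (sure_ms (hP.mono_zero hμ.le) hL hq m x₀).imp fun r hr => ?_
    rcases hr.1 with hk | hv
    · refine (ih r.value _ le_rfl).imp fun r' hr' => ?_
      simp only [Outcome.after]
      refine ⟨Or.inl (by omega), ?_⟩
      have h1 := hr.2
      have h2 := hr'.2
      rw [mul_add]
      omega
    · have h1 := hgap _ _ _ hs hv
      have h2 := hP.lowerQuad q r.value
      have h3 : gradient h q + gradient g q = 0 :=
        (hP.upperQuad_h.add hP.upperQuad_g).gradient_eq_zero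
          (by have := hP.lg_nonneg; positivity) hq
      simp only [h3, inner_zero_left, add_zero] at h2
      have h4 : ‖r.value - q‖ ^ 2 ≤ s / 2 := by
        have : μ / 2 * ‖r.value - q‖ ^ 2 ≤ μ / 2 * (s / 2) := by linarith
        exact le_of_mul_le_mul_left this (by positivity)
      refine (ih r.value _ h4).imp fun r' hr' => ?_
      simp only [Outcome.after]
      refine ⟨hr'.1.imp (fun _ => by omega) fun hle => hle.trans_eq ?_, ?_⟩
      · have h1 := hr.2
        have h2 := hr'.2
        rw [mul_add]
        omega
      · rw [pow_succ]; field_simp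

theorem expect_restartedMS_excess_le {ρ : ℝ}
    (hρ : ∀ c, ((gmco ⟨β, L, L, N, K⟩ c).expect
      (fun x => gradient h x) (fun i x => gradient g x i)
        fun r => ((r.hCalls - 30 : ℕ) : ℝ)) ≤ ρ) (m t : ℕ) (x : Vec n) :
    ((restartedMS ⟨β, L, L, N, K⟩ m t x).expect
      (fun x => gradient h x) (fun i x => gradient g x i)
        fun r => ((r.hCalls - 31 * (m * t) : ℕ) : ℝ)) ≤ (m * t : ℕ) * ρ := by
  induction t generalizing x with
  | zero => simp [restartedMS]
  | succ t ih =>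
    rw [restartedMS, expect_bind]
    refine (expect_mono _ (Φ := fun r =>
      (m * t : ℕ) * ρ + 1 * ((r.hCalls - 31 * m : ℕ) : ℝ)) fun r => ?_).trans ?_
    · refine (expect_mono _ (Φ := fun r' => ((r.hCalls - 31 * m : ℕ) : ℝ) +
        1 * ((r'.hCalls - 31 * (m * t) : ℕ) : ℝ)) fun r' => ?_).trans ?_
      · rw [one_mul, ← Nat.cast_add, Nat.cast_le, mul_add, mul_one]
        simp only [Outcome.after]
        omega
      · rw [expect_add_const_mul]
        linarith [ih r.value]
    · rw [expect_add_const_mul, ms]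
      have := expect_msLoop_excess_le hρ m 0 x x
      push_cast at this ⊢
      linarith

end OracleSep

namespace OracleSep

open OracleProg

variable {n : ℕ} {h g : Vec n → ℝ} {β : Fin n → ℝ} {L Lg μ δ : ℝ}

/-! ### The success probability -/

/-- Markov's inequality at excess `M` over `31 * M`. Below `32 * M ≤ K` calls the cap has not been
reached, so the same event gives the accuracy and both call bounds. -/
theorem le_successEvent {q : OracleProg n (Vec n)} {xstar : Vec n} {K N M : ℕ} (hM : 0 < M)
    (hK : 32 * M ≤ K) {ε bh bg : ℝ}
    (hs : q.Sure (fun x => gradient h x) (fun i x => gradient g x i) fun r =>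
      (K ≤ r.hCalls ∨ h r.value + g r.value - (h xstar + g xstar) ≤ ε) ∧
        r.gCalls ≤ (N + n) * r.hCalls)
    (hE : (q.expect (fun x => gradient h x) (fun i x => gradient g x i)
      fun r => ((r.hCalls - 31 * M : ℕ) : ℝ)) ≤ M * δ)
    (hbh : (32 * M : ℝ) ≤ bh) (hbg : ((N : ℝ) + n) * (32 * M) ≤ bg) :
    ENNReal.ofReal (1 - δ) ≤ (runOn h g q).toOuterMeasure (successEvent h g xstar ε bh bg) := by
  have hM' : (0 : ℝ) < M := Nat.cast_pos.mpr hM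
  refine le_toOuterMeasure_run q _ (fun r => 0 + 1 / M * ((r.hCalls - 31 * M : ℕ) : ℝ)) δ
    (fun r => by positivity) (hs.imp fun r hr => ?_) ?_
  · rcases lt_or_ge r.hCalls (32 * M) with hlt | hge
    · left
      have h1 : (r.hCalls : ℝ) ≤ 32 * M := by exact_mod_cast hlt.le
      refine ⟨hr.1.resolve_left (by omega), h1.trans hbh, le_trans ?_ hbg⟩
      calc (r.gCalls : ℝ) ≤ ((N : ℝ) + n) * r.hCalls := by exact_mod_cast hr.2
        _ ≤ _ := by gcongr
    · right
      have h1 : (M : ℝ) ≤ ((r.hCalls - 31 * M : ℕ) : ℝ) := Nat.cast_le.mpr (by omega)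
      rw [zero_add, one_div_mul_eq_div, le_div_iff₀ hM']
      linarith
  · rw [expect_add_const_mul, zero_add, one_div_mul_eq_div, div_le_iff₀ hM']
    linarith

/-! ### Constants -/

theorem le_rootSum_div (hβ : ∀ i, 0 ≤ β i) (hL : 0 < L) :
    (n : ℝ) ≤ rootSum β (L + L) / √(L + L) := by
  have hs : 0 < √(L + L) := Real.sqrt_pos.mpr (by positivity)
  rw [le_div_iff₀ hs, rootSum]
  calc (n : ℝ) * √(L + L) = ∑ _i : Fin n, √(L + L) := by simp
    _ ≤ _ := Finset.sum_le_sum fun i _ => Real.sqrt_le_sqrt (by linarith [hβ i])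

theorem sqrt_meanConst : √(meanConst β) = (1 / (n : ℝ)) * ∑ i, √(β i) :=
  Real.sqrt_sq (by positivity)

variable [NeZero n]

/-- By subadditivity of the root the proximal terms contribute an extra `n`, absorbed because `L ≤
meanConst β`. -/
theorem rootSum_div_le (hβ : ∀ i, 0 ≤ β i) (hL : 0 < L) (hmean : L ≤ meanConst β) :
    rootSum β (L + L) / √(L + L) ≤ 2 * (n * √(meanConst β / L)) := by
  have hs : 0 < √(L + L) := Real.sqrt_pos.mpr (by positivity)
  have hsL : 0 < √L := Real.sqrt_pos.mpr hL
  have hn : (0 : ℝ) < n := Nat.cast_pos.mpr (NeZero.pos n)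
  have h1 : rootSum β (L + L) ≤ n * √(meanConst β) + n * √(L + L) := by
    rw [sqrt_meanConst, rootSum, ← mul_assoc, mul_one_div_cancel hn.ne', one_mul]
    calc ∑ i, √(β i + (L + L)) ≤ ∑ i, (√(β i) + √(L + L)) :=
          Finset.sum_le_sum fun i _ => by
            refine Real.sqrt_le_iff.mpr ⟨by positivity, ?_⟩
            rw [add_sq, Real.sq_sqrt (hβ i), Real.sq_sqrt (by positivity)]
            have : 0 ≤ 2 * √(β i) * √(L + L) := by positivity
            linarith
      _ = _ := by simp [Finset.sum_add_distrib]
  have h2 : √(meanConst β) / √(L + L) ≤ √(meanConst β / L) := by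
    rw [Real.sqrt_div' _ hL.le]
    exact div_le_div_of_nonneg_left (Real.sqrt_nonneg _) hsL (Real.sqrt_le_sqrt (by linarith))
  have h3 : 1 ≤ √(meanConst β / L) := by
    rw [Real.one_le_sqrt, le_div_iff₀ hL]
    linarith
  calc rootSum β (L + L) / √(L + L) ≤ (n * √(meanConst β) + n * √(L + L)) / √(L + L) := by gcongr
    _ = n * (√(meanConst β) / √(L + L)) + n * 1 := by field_simp
    _ ≤ n * √(meanConst β / L) + n * √(meanConst β / L) := by gcongr
    _ = _ := by ring

theorem half_le_log (hκ : 0 ≤ Lg / L) (hδ : 0 < δ) (hδ1 : δ < 1) :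
    1 / 2 ≤ Real.log ((2 + Lg / L) / δ) := by
  have h1 : 2 ≤ (2 + Lg / L) / δ := by
    rw [le_div_iff₀ hδ]
    linarith
  have h2 := Real.log_le_log two_pos h1
  linarith [Real.log_two_gt_d9]

theorem innerSteps_add_le (hβ : ∀ i, 0 ≤ β i) (hL : 0 < L) (hmean : L ≤ meanConst β)
    (hκ : 0 ≤ Lg / L) (hδ : 0 < δ) (hδ1 : δ < 1) :
    (innerSteps 120 β L Lg L δ : ℝ) + n ≤
      248 * Real.log ((2 + Lg / L) / δ) * (n * √(meanConst β / L)) := by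
  have hX := le_rootSum_div hβ hL
  have hX2 := rootSum_div_le hβ hL hmean
  have hl := half_le_log hκ hδ hδ1
  have hn : (1 : ℝ) ≤ n := Nat.one_le_cast.mpr (NeZero.pos n)
  rw [innerSteps]
  set X := rootSum β (L + L) / √(L + L)
  set l := Real.log ((2 + Lg / L) / δ)
  have hX0 : 0 ≤ X := by linarith
  have h1 : (⌈120 * X * l⌉₊ : ℝ) < 120 * X * l + 1 :=
    Nat.ceil_lt_add_one (by positivity)
  have h2 : X * (1 / 2) ≤ X * l := mul_le_mul_of_nonneg_left hl hX0
  have h3 : l * X ≤ l * (2 * (n * √(meanConst β / L))) :=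
    mul_le_mul_of_nonneg_left hX2 (by linarith)
  linarith

/-- With `X = S / √(2 L) ≥ 1` one has `τ ≥ 2 / (5 X)`, so `120 X l` steps give `(1 - τ) ^ N ≤ (δ /
κ) ^ 48`. Three factors provide `δ / κ ^ 3`; the other `45` are at most `1/2` each and beat `10 ^
11`. -/
theorem rate_le (hβ : ∀ i, 0 ≤ β i) (hL : 0 < L) (hκ : 0 ≤ Lg / L) (hδ : 0 < δ) (hδ1 : δ < 1) :
    2 * (1 - rcdTau β (L + L) L) ^ innerSteps 120 β L Lg L δ ≤
      δ / (10 ^ 11 * (2 + Lg / L) ^ 3) := by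
  have hX := le_rootSum_div hβ hL
  have hl := half_le_log hκ hδ hδ1
  have hn : (1 : ℝ) ≤ n := Nat.one_le_cast.mpr (NeZero.pos n)
  have hw : ∀ i, 0 < β i + (L + L) := fun i => by
    have := hβ i
    positivity
  have hs : 0 < √(L + L) := Real.sqrt_pos.mpr (by positivity)
  obtain ⟨hτ0, hτ1, -⟩ := rcdTau_spec hw hL
  have hN : 120 * (rootSum β (L + L) / √(L + L)) * Real.log ((2 + Lg / L) / δ) ≤
      innerSteps 120 β L Lg L δ := Nat.le_ceil _
  have hτ : 2 / (5 * (rootSum β (L + L) / √(L + L))) ≤ rcdTau β (L + L) L := by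
    have e : 4 * rootSum β (L + L) ^ 2 / L = 8 * (rootSum β (L + L) / √(L + L)) ^ 2 := by
      rw [div_pow, Real.sq_sqrt (by positivity)]
      field_simp
      ring
    rw [rcdTau, e]
    set X := rootSum β (L + L) / √(L + L)
    have h1 : √(1 + 8 * X ^ 2) ≤ 1 + 3 * X := Real.sqrt_le_iff.mpr ⟨by linarith, by nlinarith⟩
    exact div_le_div_of_nonneg_left two_pos.le (by positivity) (by linarith)
  set X := rootSum β (L + L) / √(L + L)
  set N := innerSteps 120 β L Lg L δ
  set l := Real.log ((2 + Lg / L) / δ) with hldef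
  set τ := rcdTau β (L + L) L
  have hX0 : 0 < X := by linarith
  have h1 : 48 * l ≤ τ * N := by
    calc 48 * l = 2 / (5 * X) * (120 * X * l) := by field_simp; norm_num
      _ ≤ τ * N := by gcongr
  have h2 : (1 - τ) ^ N ≤ (δ / (2 + Lg / L)) ^ 48 := by
    calc (1 - τ) ^ N ≤ Real.exp (-τ) ^ N :=
          pow_le_pow_left₀ (by linarith) (by linarith [Real.add_one_le_exp (-τ)]) N
      _ = Real.exp (-(τ * N)) := by rw [← Real.exp_nat_mul]; ring_nf
      _ ≤ Real.exp (-(48 * l)) := Real.exp_le_exp.mpr (by linarith)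
      _ = Real.exp (-l) ^ 48 := by rw [← Real.exp_nat_mul]; push_cast; ring_nf
      _ = _ := by rw [hldef, Real.exp_neg, Real.exp_log (by positivity), inv_div]
  set κ := 2 + Lg / L with hκdef
  have hκ2 : 2 ≤ κ := by linarith
  have h3 : δ / κ ≤ 1 / 2 := by
    rw [div_le_div_iff₀ (by positivity) two_pos]
    linarith
  have h4 : (δ / κ) ^ 3 ≤ δ / κ ^ 3 := by
    rw [div_pow]
    gcongr
    exact pow_le_of_le_one hδ.le hδ1.le (by norm_num)
  calc 2 * (1 - τ) ^ N ≤ 2 * (δ / κ) ^ 48 := by gcongr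
    _ = 2 * (δ / κ) ^ 45 * (δ / κ) ^ 3 := by ring
    _ ≤ 2 * (1 / 2) ^ 45 * (δ / κ ^ 3) := by gcongr
    _ ≤ 1 / 10 ^ 11 * (δ / κ ^ 3) := by gcongr; norm_num
    _ = _ := by field_simp

/-- The gradient at the centre adds one call to the `29` passes; the excess is at most `29 * δ /
100`. -/
theorem expect_gmco_excess_le (hP : IsProblem h g β L Lg 0) (hL : 0 < L) (hδ : 0 < δ)
    (hδ1 : δ < 1) (K : ℕ) (c : Vec n) :
    ((gmco ⟨β, L, L, innerSteps 120 β L Lg L δ, K⟩ c).expect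
      (fun x => gradient h x) (fun i x => gradient g x i)
        fun r => ((r.hCalls - 30 : ℕ) : ℝ)) ≤ δ := by
  have hκ : 0 ≤ Lg / L := div_nonneg hP.lg_nonneg hL.le
  have h1 := rate_le hP.beta_nonneg hL hκ hδ hδ1
  have h2 : δ / (10 ^ 11 * (2 + Lg / L) ^ 3) ≤ 1 / (10000 * (2 + Lg / L)) := by
    have e1 : (2 + Lg / L) ^ 1 ≤ (2 + Lg / L) ^ 3 := pow_le_pow_right₀ (by linarith) (by norm_num)
    exact div_le_div₀ zero_le_one hδ1.le (by positivity) (by linarith)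
  rw [gmco, expect_bind, expect_askGradH]
  refine le_trans (le_of_eq ?_)
    ((expect_excess_center_le (K := K) hP hL h1 h2 c K).trans ?_)
  · refine expect_congr_of_sure (sure_of_forall _ fun r => ?_)
    simp only [Outcome.after]
    congr 1
    omega
  · have : 10 ^ 9 * (2 + Lg / L) ^ 3 * (δ / (10 ^ 11 * (2 + Lg / L) ^ 3)) = δ / 100 := by
      have : (2 + Lg / L) ^ 3 ≠ 0 := by positivity
      generalize (2 + Lg / L) ^ 3 = κ at this
      field_simp
      norm_num
    rw [this]
    linarith

/-! ### The two methods -/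

theorem convexMethod_success {R ε : ℝ} (hP : IsProblem h g β L Lg 0) (hL : 0 < L)
    (hmean : L ≤ meanConst β) (hε : 0 < ε) (hδ : 0 < δ) (hδ1 : δ < 1) {x₀ xstar : Vec n}
    (hmin : ∀ x, h xstar + g xstar ≤ h x + g x) (hR : ‖x₀ - xstar‖ ≤ R)
    (hεR : ε ≤ L * R ^ 2) {K : ℕ} (hK : 32 * ⌈√(2 * L * R ^ 2 / ε)⌉₊ ≤ K) :
    ENNReal.ofReal (1 - δ) ≤ (runOn h g (convexMethod 120 β L Lg R ε δ K x₀)).toOuterMeasure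
      (successEvent h g xstar ε (200000 * √(L * R ^ 2 / ε))
        (200000 * Real.log ((2 + Lg / L) / δ) * (n * √(meanConst β * R ^ 2 / ε)))) := by
  have hκ : 0 ≤ Lg / L := div_nonneg hP.lg_nonneg hL.le
  have hl := half_le_log hκ hδ hδ1
  set r := √(L * R ^ 2 / ε) with hr
  have hr1 : 1 ≤ r := by
    rw [hr, Real.one_le_sqrt, le_div_iff₀ hε]
    linarith
  have hroot : √(2 * L * R ^ 2 / ε) = √2 * r := by
    rw [hr, ← Real.sqrt_mul two_pos.le]
    congr 1
    ring
  have hR2 : 0 < R ^ 2 := pos_of_mul_pos_right (hε.trans_le hεR) hL.le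
  have hmle : √(2 * L * R ^ 2 / ε) ≤ ⌈√(2 * L * R ^ 2 / ε)⌉₊ := Nat.le_ceil _
  have hmub : (⌈√(2 * L * R ^ 2 / ε)⌉₊ : ℝ) ≤ 3 * r := by
    have h1 := Nat.ceil_lt_add_one (Real.sqrt_nonneg (2 * L * R ^ 2 / ε))
    have h2 : √2 * r ≤ 2 * r := by
      gcongr
      exact Real.sqrt_le_iff.mpr ⟨by norm_num, by norm_num⟩
    linarith
  have hmpos : 0 < ⌈√(2 * L * R ^ 2 / ε)⌉₊ := Nat.ceil_pos.mpr (Real.sqrt_pos.mpr (by positivity))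
  have hm2 : 2 * L * R ^ 2 ≤ ε * (⌈√(2 * L * R ^ 2 / ε)⌉₊ : ℝ) ^ 2 := by
    have h1 := pow_le_pow_left₀ (Real.sqrt_nonneg _) hmle 2
    rw [Real.sq_sqrt (by positivity), div_le_iff₀ hε] at h1
    linarith
  unfold convexMethod params
  set m := ⌈√(2 * L * R ^ 2 / ε)⌉₊
  have hE := expect_msLoop_excess_le (expect_gmco_excess_le hP hL hδ hδ1 K) m 0 x₀ x₀
  refine le_successEvent (N := innerSteps 120 β L Lg L δ) hmpos hK
    ((sure_ms hP hL hmin m x₀).imp fun r hr => ⟨hr.1.imp id fun hle => ?_, hr.2⟩) hE ?_ ?_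
  · have h1 : ‖x₀ - xstar‖ ^ 2 ≤ R ^ 2 := pow_le_pow_left₀ (norm_nonneg _) hR 2
    have h2 : 2 * L * ‖x₀ - xstar‖ ^ 2 ≤ 2 * L * R ^ 2 := by gcongr
    have h3 : (0 : ℝ) < (m : ℝ) ^ 2 := by positivity
    refine le_of_mul_le_mul_left ((hle.trans h2).trans (hm2.trans_eq ?_)) h3
    ring
  · linarith
  · have h1 := innerSteps_add_le hP.beta_nonneg hL hmean hκ hδ hδ1
    have h2 : √(meanConst β / L) * r = √(meanConst β * R ^ 2 / ε) := by
      rw [hr, ← Real.sqrt_mul (div_nonneg (hL.le.trans hmean) hL.le)]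
      congr 1
      field_simp
    rw [← h2]
    set Y := (n : ℝ) * √(meanConst β / L)
    have h3 : 0 ≤ Y * r := by positivity
    calc _ ≤ 248 * Real.log ((2 + Lg / L) / δ) * Y * (32 * (3 * r)) := by gcongr
      _ = 23808 * Real.log ((2 + Lg / L) / δ) * (Y * r) := by ring
      _ ≤ 200000 * Real.log ((2 + Lg / L) / δ) * (Y * r) := by gcongr; norm_num
      _ = _ := by ring

theorem ceil_logb_add_one_le {v : ℝ} (hv : 0 ≤ v) :
    ((⌈Real.logb 2 v⌉₊ + 1 : ℕ) : ℝ) ≤ 5 * Real.log (2 + v) := by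
  have hlog2 := Real.log_two_gt_d9
  have hl : Real.log 2 ≤ Real.log (2 + v) := Real.log_le_log two_pos (by linarith)
  have h1 : Real.logb 2 v ≤ Real.log (2 + v) / Real.log 2 := by
    rcases hv.eq_or_lt with rfl | hv
    -- For `v = 0`, as when `R = 0`, the default `logb 2 0 = 0` leaves a single run.
    · simp only [Real.logb_zero, add_zero]
      positivity
    · exact div_le_div_of_nonneg_right (Real.log_le_log hv (by linarith)) (by linarith)
  have h2 : Real.log (2 + v) / Real.log 2 ≤ 2 * Real.log (2 + v) := by
    rw [div_le_iff₀ (by linarith)]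
    nlinarith
  have h3 : (⌈Real.logb 2 v⌉₊ : ℝ) ≤ 2 * Real.log (2 + v) + 1 :=
    (Nat.cast_le.mpr (Nat.ceil_mono (h1.trans h2))).trans
      (Nat.ceil_lt_add_one (by linarith)).le
  push_cast
  linarith

theorem stronglyConvexMethod_success {R ε : ℝ} (hP : IsProblem h g β L Lg μ) (hL : 0 < L)
    (hmean : L ≤ meanConst β) (hε : 0 < ε) (hδ : 0 < δ) (hδ1 : δ < 1) {x₀ xstar : Vec n}
    (hmin : ∀ x, h xstar + g xstar ≤ h x + g x) (hR : ‖x₀ - xstar‖ ≤ R)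
    (hμ : 0 < μ) (hμL : μ ≤ L) {K : ℕ}
    (hK : 32 * (⌈√(8 * L / μ)⌉₊ * (⌈Real.logb 2 (μ * R ^ 2 / ε)⌉₊ + 1)) ≤ K) :
    ENNReal.ofReal (1 - δ) ≤
      (runOn h g (stronglyConvexMethod 120 β L Lg μ R ε δ K x₀)).toOuterMeasure
      (successEvent h g xstar ε (200000 * Real.log (2 + μ * R ^ 2 / ε) * √(L / μ))
        (200000 * Real.log (2 + μ * R ^ 2 / ε) * Real.log ((2 + Lg / L) / δ) *
          (n * √(meanConst β / μ)))) := by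
  have hP0 := hP.mono_zero hμ.le
  have hκ : 0 ≤ Lg / L := div_nonneg hP.lg_nonneg hL.le
  have hl := half_le_log hκ hδ hδ1
  set r := √(L / μ) with hr
  have hr1 : 1 ≤ r := by
    rw [hr, Real.one_le_sqrt, le_div_iff₀ hμ]
    linarith
  have hroot : √(8 * L / μ) = √8 * r := by
    rw [hr, ← Real.sqrt_mul (by norm_num)]
    congr 1
    ring
  have hmub : (⌈√(8 * L / μ)⌉₊ : ℝ) ≤ 4 * r := by
    have h1 := Nat.ceil_lt_add_one (Real.sqrt_nonneg (8 * L / μ))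
    have h2 : √8 * r ≤ 3 * r := by
      gcongr
      exact Real.sqrt_le_iff.mpr ⟨by norm_num, by norm_num⟩
    linarith
  have hmpos : 0 < ⌈√(8 * L / μ)⌉₊ := Nat.ceil_pos.mpr (Real.sqrt_pos.mpr (by positivity))
  have hm2 : 8 * L ≤ μ * (⌈√(8 * L / μ)⌉₊ : ℝ) ^ 2 := by
    have h1 := pow_le_pow_left₀ (Real.sqrt_nonneg _) (Nat.le_ceil √(8 * L / μ)) 2
    rw [Real.sq_sqrt (by positivity), div_le_iff₀ hμ] at h1
    linarith
  have hv : 0 ≤ μ * R ^ 2 / ε := by positivity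
  have htub := ceil_logb_add_one_le hv
  have htlb : μ * R ^ 2 / ε ≤ 2 ^ ⌈Real.logb 2 (μ * R ^ 2 / ε)⌉₊ := by
    rcases hv.eq_or_lt with hv0 | hv0
    · rw [← hv0]; positivity
    · have h1 := (Real.logb_le_iff_le_rpow one_lt_two hv0).mp
        (Nat.le_ceil (Real.logb 2 (μ * R ^ 2 / ε)))
      rwa [Real.rpow_natCast] at h1
  have hl2 : 0 ≤ Real.log (2 + μ * R ^ 2 / ε) := Real.log_nonneg (by linarith)
  unfold stronglyConvexMethod params
  set m := ⌈√(8 * L / μ)⌉₊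
  set t := ⌈Real.logb 2 (μ * R ^ 2 / ε)⌉₊
  set l₂ := Real.log (2 + μ * R ^ 2 / ε)
  have hE := expect_restartedMS_excess_le (expect_gmco_excess_le hP0 hL hδ hδ1 K) m (t + 1) x₀
  have hMub : ((m * (t + 1) : ℕ) : ℝ) ≤ 20 * (l₂ * r) := by
    rw [Nat.cast_mul]
    calc (m : ℝ) * ((t + 1 : ℕ) : ℝ) ≤ (4 * r) * (5 * l₂) := by gcongr
      _ = _ := by ring
  have h0 : 0 ≤ l₂ * r := by positivity
  refine le_successEvent (N := innerSteps 120 β L Lg L δ) (by positivity) hK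
    ((sure_restartedMS hP hL hμ hmin hm2 t x₀ (R ^ 2)
      (pow_le_pow_left₀ (norm_nonneg _) hR 2)).imp
        fun r hr => ⟨hr.1.imp id fun hle => hle.trans ?_, hr.2⟩) hE ?_ ?_
  · linarith
  · have h1 := innerSteps_add_le hP.beta_nonneg hL hmean hκ hδ hδ1
    have h2 : √(meanConst β / L) * r = √(meanConst β / μ) := by
      rw [hr, ← Real.sqrt_mul (div_nonneg (hL.le.trans hmean) hL.le)]
      congr 1
      field_simp
    rw [← h2]
    set Y := (n : ℝ) * √(meanConst β / L)
    have h3 : 0 ≤ l₂ * Real.log ((2 + Lg / L) / δ) * (Y * r) := by positivity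
    calc _ ≤ 248 * Real.log ((2 + Lg / L) / δ) * Y * (32 * (20 * (l₂ * r))) := by gcongr
      -- Here `158720 = 248 * 32 * 20`, the largest constant met, so `C = 200000` serves all four
      -- bounds.
      _ = 158720 * (l₂ * Real.log ((2 + Lg / L) / δ) * (Y * r)) := by ring
      _ ≤ 200000 * (l₂ * Real.log ((2 + Lg / L) / δ) * (Y * r)) := by gcongr; norm_num
      _ = _ := by ring
  · rw [div_le_iff₀ (by positivity)]
    rw [div_le_iff₀ hε] at htlb
    have : 0 ≤ μ * R ^ 2 := by positivity
    linarith

end OracleSep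

end

theorem corollary2 :
    ∃ c C : ℝ, 0 < c ∧ 0 < C ∧
      ∀ (n : ℕ) [NeZero n] (β : Fin n → ℝ) (Lh Lg μ R ε δ : ℝ),
        0 < Lh → Lh ≤ OracleSep.meanConst β → 0 < ε → 0 < δ → δ < 1 →
        ∃ K₀ : ℕ, ∀ K : ℕ, K₀ ≤ K →
          ∀ (h g : OracleSep.Vec n → ℝ) (x₀ xstar : OracleSep.Vec n),
            OracleSep.IsProblem h g β Lh Lg μ →
            (∀ x, h xstar + g xstar ≤ h x + g x) →
            ‖x₀ - xstar‖ ≤ R →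
            (μ = 0 → ε ≤ Lh * R ^ 2 →
              ENNReal.ofReal (1 - δ) ≤
                (OracleSep.runOn h g
                  (OracleSep.convexMethod c β Lh Lg R ε δ K x₀)).toOuterMeasure
                  (OracleSep.successEvent h g xstar ε
                    (C * √(Lh * R ^ 2 / ε))
                    (C * Real.log ((2 + Lg / Lh) / δ) *
                      (n * √(OracleSep.meanConst β * R ^ 2 / ε))))) ∧
            (0 < μ → μ ≤ Lh →
              ENNReal.ofReal (1 - δ) ≤
                (OracleSep.runOn h g
                  (OracleSep.stronglyConvexMethod c β Lh Lg μ R ε δ K x₀)).toOuterMeasure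
                  (OracleSep.successEvent h g xstar ε
                    (C * Real.log (2 + μ * R ^ 2 / ε) * √(Lh / μ))
                    (C * Real.log (2 + μ * R ^ 2 / ε) * Real.log ((2 + Lg / Lh) / δ) *
                      (n * √(OracleSep.meanConst β / μ))))) := by
  refine ⟨120, 200000, by norm_num, by norm_num, ?_⟩
  intro n _ β Lh Lg μ R ε δ hL hmean hε hδ hδ1
  -- The sum dominates the cap thresholds of both methods and involves neither the functions nor the
  -- starting point.
  refine ⟨32 * ⌈√(2 * Lh * R ^ 2 / ε)⌉₊ +
    32 * (⌈√(8 * Lh / μ)⌉₊ * (⌈Real.logb 2 (μ * R ^ 2 / ε)⌉₊ + 1)), ?_⟩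
  intro K hK h g x₀ xstar hP hmin hR
  refine ⟨fun hμ hεR => ?_, fun hμ hμL => ?_⟩
  · subst hμ
    exact OracleSep.convexMethod_success hP hL hmean hε hδ hδ1 hmin hR hεR (by omega)
  · exact OracleSep.stronglyConvexMethod_success hP hL hmean hε hδ hδ1 hmin hR hμ hμL (by omega)
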